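/- An instance of \textsc{min bp sm restricted} consists of a bipartite graph $G=(U\cup W,E)$ with $n$ vertices (men $U$, women $W$), for each vertex a strict preference order (preference list) of its neighbours, a set $P\subseteq E$ of forbidden edges and a set $Q\subseteq E$ of forced edges with $P\cap Q=\emptyset$. An edge $uw\in E\setminus M$ blocks a matching $M$ if each of $u$ and $w$ is unmatched in $M$ or prefers the other to its partner in $M$; $bp(M)$ is the set of edges blocking $M$. The task is to find a matching $M$ with $M\cap P=\emptyset$ and $Q\subseteq M$ such that $|bp(M)|\le |bp(M')|$ for every matching $M'$ of $G$ with $M'\cap P=\emptyset$ and $Q\subseteq M'$, or to report that no matching satisfies these constraints. **Theorem.** \textsc{min bp sm restricted} is solvable in $O(n)$ time on the instances in which every preference list has length at most $2$. That is, there are one program for a random access machine (unit-cost reads, writes, additions, subtractions and comparisons on words of $\log_2 n+O(1)$ bits) and a constant $C$ such that on every instance all of whose preference lists have length at most $2$, given by its preference lists with each entry labelled forbidden, forced or unrestricted, the program halts with a correct answer within $C(n+1)$ steps. -/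

import Mathlib

/-- An instance `(G, O, P, Q)` of the stable marriage problem with restricted edges.
The men are `Fin nU`, the women are `Fin nW`, every agent has a strictly ordered (repetition-free,
possibly incomplete) preference list, best choice first, and acceptability is mutual; `man u` and
`woman w` are joined by an edge exactly if they occur on each other's lists. `P` is the set of
forbidden edges and `Q` is the set of forced edges. -/
structure RestrictedSM where
  nU : ℕ
  nW : ℕ
  prefU : Fin nU → List (Fin nW)
  prefW : Fin nW → List (Fin nU)
  nodupU : ∀ u, (prefU u).Nodup
  nodupW : ∀ w, (prefW w).Nodup
  mutual_acceptable : ∀ u w, w ∈ prefU u ↔ u ∈ prefW w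
  P : Finset (Fin nU × Fin nW)
  Q : Finset (Fin nU × Fin nW)
  P_edges : ∀ e ∈ P, e.2 ∈ prefU e.1
  Q_edges : ∀ e ∈ Q, e.2 ∈ prefU e.1
  disjoint_PQ : Disjoint P Q

namespace RestrictedSM

variable (I : RestrictedSM)

/-- The number of vertices. -/
def n : ℕ := I.nU + I.nW

/-- The edge set of the bipartite graph. -/
def edges : Finset (Fin I.nU × Fin I.nW) := Finset.univ.filter fun e => e.2 ∈ I.prefU e.1

/-- Man `u` prefers `w` to `w'` (for `w`, `w'` on his list). -/
def ManPrefers (u : Fin I.nU) (w w' : Fin I.nW) : Prop :=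
  (I.prefU u).idxOf w < (I.prefU u).idxOf w'

/-- Woman `w` prefers `u` to `u'` (for `u`, `u'` on her list). -/
def WomanPrefers (w : Fin I.nW) (u u' : Fin I.nU) : Prop :=
  (I.prefW w).idxOf u < (I.prefW w).idxOf u'

/-- `M` is a matching in the graph: a set of edges, no two of which share an agent. -/
def IsMatching (M : Finset (Fin I.nU × Fin I.nW)) : Prop :=
  M ⊆ I.edges ∧ ∀ e ∈ M, ∀ f ∈ M, (e.1 = f.1 ∨ e.2 = f.2) → e = f

/-- The edge `e` blocks `M`: it is not in `M`, and each of its two ends is unmatched or prefers the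
other end to its partner. -/
def Blocks (M : Finset (Fin I.nU × Fin I.nW)) (e : Fin I.nU × Fin I.nW) : Prop :=
  e ∈ I.edges ∧ e ∉ M ∧
    (∀ w', (e.1, w') ∈ M → I.ManPrefers e.1 e.2 w') ∧
    (∀ u', (u', e.2) ∈ M → I.WomanPrefers e.2 e.1 u')

instance (M : Finset (Fin I.nU × Fin I.nW)) : DecidablePred (I.Blocks M) := fun e => by
  unfold Blocks ManPrefers WomanPrefers
  infer_instance

/-- The set of edges blocking `M`. -/
def bp (M : Finset (Fin I.nU × Fin I.nW)) : Finset (Fin I.nU × Fin I.nW) :=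
  I.edges.filter (I.Blocks M)

/-- `M` is a matching satisfying all constraints on restricted edges. -/
def IsFeasible (M : Finset (Fin I.nU × Fin I.nW)) : Prop :=
  I.IsMatching M ∧ Disjoint M I.P ∧ I.Q ⊆ M

/-- `M` has the fewest blocking edges among all matchings that satisfy the constraints. -/
def IsOptimal (M : Finset (Fin I.nU × Fin I.nW)) : Prop :=
  I.IsFeasible M ∧ ∀ M', I.IsFeasible M' → (I.bp M).card ≤ (I.bp M').card

/-- Every preference list has length at most `k`. -/
def ListsBoundedBy (k : ℕ) : Prop :=
  (∀ u, (I.prefU u).length ≤ k) ∧ ∀ w, (I.prefW w).length ≤ k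

end RestrictedSM

/-! ### Random access machine

Structured programs on a random access machine whose memory consists of registers and of banks
(arrays) of words. A program mentions only finitely many registers and banks. There is no
multiplication. -/

namespace RAM

/-- The contents of the registers and of the memory banks. -/
structure State where
  reg : ℕ → ℕ
  mem : ℕ → ℕ → ℕ

/-- The state after writing `v` to register `r`. -/
def State.setReg (s : State) (r v : ℕ) : State :=
  { s with reg := Function.update s.reg r v }

/-- The state after writing `v` to cell `i` of bank `b`. -/
def State.setMem (s : State) (b i v : ℕ) : State :=
  { s with mem := Function.update s.mem b (Function.update (s.mem b) i v) }

/-- Expressions: constants, registers, indirect memory access, addition, truncated subtraction and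
comparisons (with value `1` for true and `0` for false). -/
inductive Expr where
  | const (k : ℕ)
  | reg (r : ℕ)
  | load (b : ℕ) (i : Expr)
  | add (x y : Expr)
  | sub (x y : Expr)
  | lt (x y : Expr)
  | eq (x y : Expr)

namespace Expr

/-- The value of an expression. -/
def eval (s : State) : Expr → ℕ
  | const k => k
  | reg r => s.reg r
  | load b i => s.mem b (i.eval s)
  | add x y => x.eval s + y.eval s
  | sub x y => x.eval s - y.eval s
  | lt x y => if x.eval s < y.eval s then 1 else 0
  | eq x y => if x.eval s = y.eval s then 1 else 0

/-- The time for evaluating an expression: one unit for each operation in it. -/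
def time : Expr → ℕ
  | const _ => 1
  | reg _ => 1
  | load _ i => i.time + 1
  | add x y => x.time + y.time + 1
  | sub x y => x.time + y.time + 1
  | lt x y => x.time + y.time + 1
  | eq x y => x.time + y.time + 1

/-- All values that occur in the evaluation are machine words, that is, at most `B`. -/
def Fits (B : ℕ) (s : State) : Expr → Prop
  | const k => k ≤ B
  | reg r => s.reg r ≤ B
  | load b i => i.Fits B s ∧ s.mem b (i.eval s) ≤ B
  | add x y => x.Fits B s ∧ y.Fits B s ∧ x.eval s + y.eval s ≤ B
  | sub x y => x.Fits B s ∧ y.Fits B s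
  | lt x y => x.Fits B s ∧ y.Fits B s ∧ 1 ≤ B
  | eq x y => x.Fits B s ∧ y.Fits B s ∧ 1 ≤ B

end Expr

/-- Programs. A condition counts as true if its value is not `0`. -/
inductive Cmd where
  | skip
  | assign (r : ℕ) (e : Expr)
  | store (b : ℕ) (i e : Expr)
  | seq (c d : Cmd)
  | branch (e : Expr) (c d : Cmd)
  | loop (e : Expr) (c : Cmd)

/-- `Exec B c s s' t`: on a machine whose words are the numbers `0, …, B`, the program `c` started
in state `s` halts in state `s'` after `t` units of time. A run that would produce a number
exceeding `B` has no derivation. -/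
inductive Exec (B : ℕ) : Cmd → State → State → ℕ → Prop
  | skip (s : State) : Exec B .skip s s 1
  | assign (r : ℕ) (e : Expr) (s : State) (he : e.Fits B s) :
      Exec B (.assign r e) s (s.setReg r (e.eval s)) (e.time + 1)
  | store (b : ℕ) (i e : Expr) (s : State) (hi : i.Fits B s) (he : e.Fits B s) :
      Exec B (.store b i e) s (s.setMem b (i.eval s) (e.eval s)) (i.time + e.time + 1)
  | seq {c d : Cmd} {s s₁ s₂ : State} {t₁ t₂ : ℕ} (hc : Exec B c s s₁ t₁)
      (hd : Exec B d s₁ s₂ t₂) : Exec B (.seq c d) s s₂ (t₁ + t₂)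
  | branch_true {e : Expr} {c d : Cmd} {s s₁ : State} {t : ℕ} (he : e.Fits B s)
      (h : e.eval s ≠ 0) (hc : Exec B c s s₁ t) : Exec B (.branch e c d) s s₁ (e.time + 1 + t)
  | branch_false {e : Expr} {c d : Cmd} {s s₁ : State} {t : ℕ} (he : e.Fits B s)
      (h : e.eval s = 0) (hd : Exec B d s s₁ t) : Exec B (.branch e c d) s s₁ (e.time + 1 + t)
  | loop_false {e : Expr} {c : Cmd} {s : State} (he : e.Fits B s) (h : e.eval s = 0) :
      Exec B (.loop e c) s s (e.time + 1)
  | loop_true {e : Expr} {c : Cmd} {s s₁ s₂ : State} {t₁ t₂ : ℕ} (he : e.Fits B s)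
      (h : e.eval s ≠ 0) (hc : Exec B c s s₁ t₁) (hl : Exec B (.loop e c) s₁ s₂ t₂) :
      Exec B (.loop e c) s s₂ (e.time + 1 + t₁ + t₂)

/-- The machine is deterministic: the final state and the running time are determined by the
program and the initial state. -/
theorem Exec.deterministic {B : ℕ} {c : Cmd} {s s₁ s₂ : State} {t₁ t₂ : ℕ}
    (h₁ : Exec B c s s₁ t₁) (h₂ : Exec B c s s₂ t₂) : s₁ = s₂ ∧ t₁ = t₂ := by
  induction h₁ generalizing s₂ t₂ with
  | skip | assign | store => cases h₂; exact ⟨rfl, rfl⟩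
  | seq hc hd ihc ihd =>
    cases h₂ with
    | seq hc' hd' =>
      obtain ⟨rfl, rfl⟩ := ihc hc'
      obtain ⟨rfl, rfl⟩ := ihd hd'
      exact ⟨rfl, rfl⟩
  | branch_true he h hc ih =>
    cases h₂ with
    | branch_true he' h' hc' => obtain ⟨rfl, rfl⟩ := ih hc'; exact ⟨rfl, rfl⟩
    | branch_false he' h' hd' => exact absurd h' h
  | branch_false he h hd ih =>
    cases h₂ with
    | branch_true he' h' hc' => exact absurd h h'
    | branch_false he' h' hd' => obtain ⟨rfl, rfl⟩ := ih hd'; exact ⟨rfl, rfl⟩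
  | loop_false he h =>
    cases h₂ with
    | loop_false => exact ⟨rfl, rfl⟩
    | loop_true he' h' hc' hl' => exact absurd h h'
  | loop_true he h hc hl ihc ihl =>
    cases h₂ with
    | loop_false he' h' => exact absurd h' h
    | loop_true he' h' hc' hl' =>
      obtain ⟨rfl, rfl⟩ := ihc hc'
      obtain ⟨rfl, rfl⟩ := ihl hl'
      exact ⟨rfl, rfl⟩

end RAM

namespace RestrictedSM

variable (I : RestrictedSM)

/-- The label of an edge: `1` for forbidden, `2` for forced, `0` for unrestricted. -/
def label (u : Fin I.nU) (w : Fin I.nW) : ℕ :=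
  if (u, w) ∈ I.P then 1 else if (u, w) ∈ I.Q then 2 else 0

/-- The start positions of the rows of an array of rows that are stored one after another,
followed by the total length. -/
def rowStarts {k : ℕ} {α : Type} (f : Fin k → List α) : List ℕ :=
  (List.range (k + 1)).map fun i => (((List.ofFn f).take i).flatten).length

/-- The adjacency-list representation of the instance. The preference lists of the men are stored
one after another (bank `1`), with the position at which each list starts (bank `0`) and with the
labels of the edges (bank `2`); banks `3`, `4`, `5` hold the same for the women. -/
def inputBank : ℕ → List ℕ
  | 0 => rowStarts I.prefU
  | 1 => (List.ofFn fun u => (I.prefU u).map fun w => (w : ℕ)).flatten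
  | 2 => (List.ofFn fun u => (I.prefU u).map fun w => I.label u w).flatten
  | 3 => rowStarts I.prefW
  | 4 => (List.ofFn fun w => (I.prefW w).map fun u => (u : ℕ)).flatten
  | 5 => (List.ofFn fun w => (I.prefW w).map fun u => I.label u w).flatten
  | _ => []

/-- The initial state of the machine: the numbers of men and women are in registers `0` and `1`,
the banks hold the input, and everything else is `0`. -/
def initialState : RAM.State where
  reg r := if r = 0 then I.nU else if r = 1 then I.nW else 0
  mem b i := (I.inputBank b).getD i 0

/-- Bank `6` holds the set of edges `M`: cell `u` contains `w + 1` if `M` matches man `u` to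
woman `w`, and `0` if man `u` is unmatched. -/
def Represents (s : RAM.State) (M : Finset (Fin I.nU × Fin I.nW)) : Prop :=
  ∀ u : Fin I.nU, s.mem 6 u ≤ I.nW ∧ ∀ w : Fin I.nW, (u, w) ∈ M ↔ s.mem 6 u = (w : ℕ) + 1

/-- The final state `s` answers the instance correctly: either register `0` is `1` and an optimal
matching has been written, or register `0` is `0` and no matching satisfies the constraints. -/
def IsCorrectOutput (s : RAM.State) : Prop :=
  (s.reg 0 = 1 ∧ ∃ M, I.IsOptimal M ∧ I.Represents s M) ∨
    (s.reg 0 = 0 ∧ ∀ M, ¬ I.IsFeasible M)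

end RestrictedSM

/-! A matching is encoded by giving each man a state in `{0, 1, 2}`: unmatched, or matched to the
first or second entry of his list. Since a woman has at most two neighbours, the status of an edge
`uw` (used, blocking, violating a constraint) depends only on the states of `u` and of the other man
at `w`. The task becomes the minimisation of a sum of pairwise costs on a graph whose nodes are the
men and whose links are the women. This graph has maximum degree 2, so it consists of paths and
cycles. A blocking edge costs 1, and a violated constraint costs `penalty = 2 * nU + 1`, more than
the number of edges (`card_edges_le`, `totalCost_of_feasible`, `penalty_le_totalCost`). Existence of
a feasible matching is tested separately: it means that the forced edges form a matching
(`exists_isFeasible_iff`).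

The sum is minimised by eliminating variables. Each man owns two darts, one per list position; the
mate of a dart is the rival's dart at the same woman, or a dummy dart of fixed state 0. Eliminating
a man splices his two links into one, whose table is the min-plus product of the old tables. If his
two darts are mates of each other, a cycle has shrunk to a point and contributes a constant. By
`Preserves.step` the remaining sum stays a lower bound for the capped original cost, attained
whenever the eliminated men are in locally optimal states. When only dummies are left, the remaining
sum is constant, so choosing best states in reverse order of elimination gives an optimum
(`Preserves.optimal`, `Backtracking.step`). Costs are capped at `cap = 4 * nU + 2`, which keeps them
within words and exceeds twice the cost of any feasible matching.

On the machine side, loop-free code is evaluated by the function `run`. A syntactic condition,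
`tame`, guarantees that stored values never exceed `W = 8 * (n + 1)`, while intermediate values
exceed `W` at most by a factor depending on the program. Each pass is a for loop with an invariant;
`triple_program` chains them. -/

namespace RAM

/-! ### Semantics of loop-free programs -/

@[simp] theorem State.setReg_reg (s : State) (r v r' : ℕ) :
    (s.setReg r v).reg r' = if r' = r then v else s.reg r' := by
  simp [State.setReg, Function.update_apply]

@[simp] theorem State.setReg_mem (s : State) (r v : ℕ) : (s.setReg r v).mem = s.mem := rfl

@[simp] theorem State.setMem_reg (s : State) (b i v : ℕ) : (s.setMem b i v).reg = s.reg := rfl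

@[simp] theorem State.setMem_mem (s : State) (b i v b' i' : ℕ) :
    (s.setMem b i v).mem b' i' = if b' = b ∧ i' = i then v else s.mem b' i' := by
  by_cases h : b' = b
  · subst h; simp [State.setMem, Function.update_apply]
  · simp [State.setMem, h]

/-- All registers and all memory cells are at most `W`. -/
def State.Bdd (W : ℕ) (s : State) : Prop :=
  (∀ r, s.reg r ≤ W) ∧ ∀ b i, s.mem b i ≤ W

theorem State.Bdd.setReg {W : ℕ} {s : State} (hs : s.Bdd W) (r : ℕ) {v : ℕ} (hv : v ≤ W) :
    (s.setReg r v).Bdd W := by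
  refine ⟨fun r' => ?_, hs.2⟩
  rw [State.setReg_reg]
  split_ifs
  exacts [hv, hs.1 _]

theorem State.Bdd.setMem {W : ℕ} {s : State} (hs : s.Bdd W) (b i : ℕ) {v : ℕ} (hv : v ≤ W) :
    (s.setMem b i v).Bdd W := by
  refine ⟨hs.1, fun b' i' => ?_⟩
  rw [State.setMem_mem]
  split_ifs
  exacts [hv, hs.2 _ _]

/-! ### Size of the values occurring in expressions -/

namespace Expr

/-- A factor by which the values in an evaluation may exceed the words of the state. -/
def weight : Expr → ℕ
  | const k => k + 1
  | reg _ => 1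
  | load _ i => i.weight + 1
  | add x y => x.weight + y.weight
  | sub x y => x.weight + y.weight
  | lt x y => x.weight + y.weight + 1
  | eq x y => x.weight + y.weight + 1

/-- Expressions whose value is a word of the state, a small constant, or smaller than these. -/
def tame : Expr → Bool
  | const k => decide (k ≤ 8)
  | reg _ => true
  | load _ _ => true
  | add _ _ => false
  | sub x _ => x.tame
  | lt _ _ => true
  | eq _ _ => true

/-- Only an outermost addition or a large constant could produce a new large value; truncated
subtraction never exceeds its first argument. An address inside a load may be arbitrary, since the
loaded word is bounded anyway. -/
theorem eval_le_of_tame {W : ℕ} (hW : 8 ≤ W) {s : State} (hs : s.Bdd W) :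
    ∀ {e : Expr}, e.tame = true → e.eval s ≤ W
  | const k, h => by simp only [tame, decide_eq_true_eq] at h; simp only [eval]; omega
  | reg r, _ => hs.1 r
  | load b i, _ => hs.2 b _
  | add _ _, h => by simp [tame] at h
  | sub x y, h => (Nat.sub_le _ _).trans (eval_le_of_tame hW hs (e := x) h)
  | lt x y, _ => by simp only [eval]; split_ifs <;> omega
  | eq x y, _ => by simp only [eval]; split_ifs <;> omega

theorem eval_le_weight {W : ℕ} (hW : 1 ≤ W) {s : State} (hs : s.Bdd W) :
    ∀ e : Expr, e.eval s ≤ e.weight * W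
  | const k => by simp only [eval, weight]; nlinarith
  | reg r => by simpa [eval, weight] using hs.1 r
  | load b i => by
    have := hs.2 b (i.eval s)
    simp only [eval, weight]; nlinarith
  | add x y => by
    have := eval_le_weight hW hs x
    have := eval_le_weight hW hs y
    simp only [eval, weight, add_mul]; omega
  | sub x y => by
    have := eval_le_weight hW hs x
    simp only [eval, weight, add_mul]; omega
  | lt x y => by
    simp only [eval, weight, add_mul, one_mul]; split_ifs <;> omega
  | eq x y => by
    simp only [eval, weight, add_mul, one_mul]; split_ifs <;> omega

/-- Intermediate sums may exceed `W`, but only by a factor fixed by the program text. This factor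
becomes the additive constant in the word length. -/
theorem fits_of_weight {W B : ℕ} (hW : 1 ≤ W) {s : State} (hs : s.Bdd W) :
    ∀ e : Expr, e.weight * W ≤ B → e.Fits B s
  | const k, h => (eval_le_weight hW hs (const k)).trans h
  | reg r, h => (eval_le_weight hW hs (reg r)).trans h
  | load b i, h => by
    have h' := hs.2 b (i.eval s)
    simp only [weight, add_mul, one_mul] at h
    exact ⟨fits_of_weight hW hs i (by omega), by omega⟩
  | add x y, h => by
    have h' := (eval_le_weight hW hs (add x y)).trans h
    simp only [weight, add_mul] at h
    exact ⟨fits_of_weight hW hs x (by omega), fits_of_weight hW hs y (by omega), h'⟩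
  | sub x y, h => by
    simp only [weight, add_mul] at h
    exact ⟨fits_of_weight hW hs x (by omega), fits_of_weight hW hs y (by omega)⟩
  | lt x y, h => by
    simp only [weight, add_mul, one_mul] at h
    exact ⟨fits_of_weight hW hs x (by omega), fits_of_weight hW hs y (by omega), by omega⟩
  | eq x y, h => by
    simp only [weight, add_mul, one_mul] at h
    exact ⟨fits_of_weight hW hs x (by omega), fits_of_weight hW hs y (by omega), by omega⟩

/-- The minimum of two expressions. -/
def min (x y : Expr) : Expr := sub x (sub x y)

@[simp] theorem eval_min (s : State) (x y : Expr) :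
    (x.min y).eval s = Min.min (x.eval s) (y.eval s) := by
  simp only [min, eval]; omega

end Expr

/-! ### Evaluation and resource bounds of programs -/

namespace Cmd

/-- The sum of the weights of the expressions in a program. -/
def weight : Cmd → ℕ
  | skip => 0
  | assign _ e => e.weight
  | store _ i e => i.weight + e.weight
  | seq c d => c.weight + d.weight
  | branch e c d => e.weight + c.weight + d.weight
  | loop e c => e.weight + c.weight

/-- A bound for the time of a program, up to a linear factor if it has loops. -/
def timeBound : Cmd → ℕ
  | skip => 1
  | assign _ e => e.time + 1
  | store _ i e => i.time + e.time + 1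
  | seq c d => c.timeBound + d.timeBound
  | branch e c d => e.time + 1 + c.timeBound + d.timeBound
  | loop e c => 4 * (e.time + 1 + c.timeBound)

/-- The program has no loop. -/
def loopFree : Cmd → Bool
  | skip => true
  | assign _ _ => true
  | store _ _ _ => true
  | seq c d => c.loopFree && d.loopFree
  | branch _ c d => c.loopFree && d.loopFree
  | loop _ _ => false

/-- The program has no loop and writes only tame values. -/
def tame : Cmd → Bool
  | skip => true
  | assign _ e => e.tame
  | store _ _ e => e.tame
  | seq c d => c.tame && d.tame
  | branch _ c d => c.tame && d.tame
  | loop _ _ => false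

/-- The program does not write to register `r`. -/
def keepsReg (r : ℕ) : Cmd → Bool
  | skip => true
  | assign r' _ => r != r'
  | store _ _ _ => true
  | seq c d => c.keepsReg r && d.keepsReg r
  | branch _ c d => c.keepsReg r && d.keepsReg r
  | loop _ c => c.keepsReg r

/-- The program does not write to bank `b`. -/
def keepsBank (b : ℕ) : Cmd → Bool
  | skip => true
  | assign _ _ => true
  | store b' _ _ => b != b'
  | seq c d => c.keepsBank b && d.keepsBank b
  | branch _ c d => c.keepsBank b && d.keepsBank b
  | loop _ c => c.keepsBank b

/-- The final state of a program without loops. -/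
def run : Cmd → State → State
  | skip, s => s
  | assign r e, s => s.setReg r (e.eval s)
  | store b i e, s => s.setMem b (i.eval s) (e.eval s)
  | seq c d, s => d.run (c.run s)
  | branch e c d, s => if e.eval s ≠ 0 then c.run s else d.run s
  | loop _ _, s => s

/-- The values written in a run are at most `W`. -/
def Safe (W : ℕ) : Cmd → State → Prop
  | skip, _ => True
  | assign _ e, s => e.eval s ≤ W
  | store _ _ e, s => e.eval s ≤ W
  | seq c d, s => c.Safe W s ∧ d.Safe W (c.run s)
  | branch e c d, s => if e.eval s ≠ 0 then c.Safe W s else d.Safe W s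
  | loop _ _, _ => True

theorem run_reg_of_keepsReg {r : ℕ} :
    ∀ {c : Cmd}, c.keepsReg r = true → ∀ s : State, (c.run s).reg r = s.reg r
  | skip, _, _ => rfl
  | assign r' e, h, s => by
    simp only [keepsReg, bne_iff_ne] at h
    simp [run, h]
  | store _ _ _, _, _ => rfl
  | seq c d, h, s => by
    simp only [keepsReg, Bool.and_eq_true] at h
    rw [run, run_reg_of_keepsReg h.2, run_reg_of_keepsReg h.1]
  | branch e c d, h, s => by
    simp only [keepsReg, Bool.and_eq_true] at h
    rw [run]
    split_ifs
    exacts [run_reg_of_keepsReg h.1 s, run_reg_of_keepsReg h.2 s]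
  | loop _ _, _, _ => rfl

theorem run_mem_of_keepsBank {b : ℕ} :
    ∀ {c : Cmd}, c.keepsBank b = true → ∀ s : State, (c.run s).mem b = s.mem b
  | skip, _, _ => rfl
  | assign _ _, _, _ => rfl
  | store b' i e, h, s => by
    simp only [keepsBank, bne_iff_ne] at h
    funext x
    simp [run, h]
  | seq c d, h, s => by
    simp only [keepsBank, Bool.and_eq_true] at h
    rw [run, run_mem_of_keepsBank h.2, run_mem_of_keepsBank h.1]
  | branch e c d, h, s => by
    simp only [keepsBank, Bool.and_eq_true] at h
    rw [run]
    split_ifs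
    exacts [run_mem_of_keepsBank h.1 s, run_mem_of_keepsBank h.2 s]
  | loop _ _, _, _ => rfl

theorem loopFree_of_tame : ∀ {c : Cmd}, c.tame = true → c.loopFree = true
  | skip, _ => rfl
  | assign _ _, _ => rfl
  | store _ _ _, _ => rfl
  | seq c d, h => by
    simp only [tame, loopFree, Bool.and_eq_true] at h ⊢
    exact ⟨loopFree_of_tame h.1, loopFree_of_tame h.2⟩
  | branch e c d, h => by
    simp only [tame, loopFree, Bool.and_eq_true] at h ⊢
    exact ⟨loopFree_of_tame h.1, loopFree_of_tame h.2⟩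
  | loop _ _, h => by simp [tame] at h

theorem Safe.bdd {W : ℕ} : ∀ {c : Cmd} {s : State}, c.Safe W s → s.Bdd W → (c.run s).Bdd W
  | skip, _, _, hs => hs
  | assign r _, _, h, hs => hs.setReg r h
  | store b _ _, _, h, hs => hs.setMem b _ h
  | seq _ _, _, h, hs => h.2.bdd (h.1.bdd hs)
  | branch e c d, s, h, hs => by
    rw [Safe] at h
    rw [run]
    split_ifs with he
    · rw [if_pos he] at h; exact h.bdd hs
    · rw [if_neg he] at h; exact h.bdd hs
  | loop _ _, _, _, hs => hs

/-- Tameness is decided by computation and does not depend on the state, so the bound `W` does not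
grow over the iterations of a loop. -/
theorem safe_of_tame {W : ℕ} (hW : 8 ≤ W) :
    ∀ {c : Cmd} {s : State}, c.tame = true → s.Bdd W → c.Safe W s
  | skip, _, _, _ => trivial
  | assign _ _, _, h, hs => Expr.eval_le_of_tame hW hs h
  | store _ _ _, _, h, hs => Expr.eval_le_of_tame hW hs h
  | seq c d, s, h, hs => by
    simp only [tame, Bool.and_eq_true] at h
    have hc := safe_of_tame hW h.1 hs
    exact ⟨hc, safe_of_tame hW h.2 (hc.bdd hs)⟩
  | branch e c d, s, h, hs => by
    simp only [tame, Bool.and_eq_true] at h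
    rw [Safe]
    split_ifs
    exacts [safe_of_tame hW h.1 hs, safe_of_tame hW h.2 hs]
  | loop _ _, _, _, _ => trivial

/-- This replaces derivations of `Exec` by the total function `run`; correctness proofs then reduce
to simplification. -/
theorem exec_run {W B : ℕ} (hW : 1 ≤ W) :
    ∀ {c : Cmd} {s : State}, c.loopFree = true → s.Bdd W → c.Safe W s → c.weight * W ≤ B →
      ∃ t ≤ c.timeBound, Exec B c s (c.run s) t
  | skip, s, _, _, _, _ => ⟨1, le_rfl, .skip s⟩
  | assign r e, s, _, hs, _, hB => ⟨_, le_rfl, .assign r e s (e.fits_of_weight hW hs hB)⟩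
  | store b i e, s, _, hs, _, hB => by
    simp only [weight, add_mul] at hB
    exact ⟨_, le_rfl, .store b i e s (i.fits_of_weight hW hs (by omega))
      (e.fits_of_weight hW hs (by omega))⟩
  | seq c d, s, hl, hs, hc, hB => by
    simp only [weight, add_mul] at hB
    simp only [loopFree, Bool.and_eq_true] at hl
    obtain ⟨t₁, ht₁, h₁⟩ := exec_run hW hl.1 hs hc.1 (B := B) (by omega)
    obtain ⟨t₂, ht₂, h₂⟩ := exec_run hW hl.2 (hc.1.bdd hs) hc.2 (B := B) (by omega)
    exact ⟨t₁ + t₂, by simp only [timeBound]; omega, .seq h₁ h₂⟩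
  | branch e c d, s, hl, hs, hc, hB => by
    simp only [weight, add_mul] at hB
    simp only [loopFree, Bool.and_eq_true] at hl
    have he := e.fits_of_weight hW hs (B := B) (by omega)
    rw [Safe] at hc
    rw [run]
    split_ifs with h
    · rw [if_pos h] at hc
      obtain ⟨t, ht, h₁⟩ := exec_run hW hl.1 hs hc (B := B) (by omega)
      exact ⟨_, by simp only [timeBound]; omega, .branch_true he h h₁⟩
    · rw [if_neg h] at hc
      obtain ⟨t, ht, h₁⟩ := exec_run hW hl.2 hs hc (B := B) (by omega)
      exact ⟨_, by simp only [timeBound]; omega, .branch_false he (not_not.1 h) h₁⟩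
  | loop _ _, _, hl, _, _, _ => by simp [loopFree] at hl

/-- Execute `c` for the values `0, 1, …` of register `i` below the value of register `b`. -/
def forLoop (i b : ℕ) (c : Cmd) : Cmd :=
  .seq (.assign i (.const 0))
    (.loop (.lt (.reg i) (.reg b)) (.seq c (.assign i (.add (.reg i) (.const 1)))))

/-- The body leaves the counter and its bound alone. The increment is not tame, but the counter
never passes the value of register `b`, which is at most `W`. The invariant must tolerate changes of
the counter (`h_reg`), because it is rewritten between iterations. -/
theorem exec_forLoop {W B m i b : ℕ} {c : Cmd} (hW : 8 ≤ W) (hc : c.tame = true)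
    (hi : c.keepsReg i = true) (hb : c.keepsReg b = true) (hib : b ≠ i)
    {s : State} (hs : s.Bdd W) (hB : (forLoop i b c).weight * W ≤ B) (hm : s.reg b ≤ 4 * m)
    (Inv : ℕ → State → Prop) (h_reg : ∀ k s v, Inv k s → Inv k (s.setReg i v)) (h0 : Inv 0 s)
    (h_step : ∀ k s', k < s.reg b → s'.reg i = k → Inv k s' → Inv (k + 1) (c.run s')) :
    ∃ s' t, Exec B (forLoop i b c) s s' t ∧ t ≤ (forLoop i b c).timeBound * (m + 1) ∧
      s'.Bdd W ∧ Inv (s.reg b) s' := by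
  simp only [forLoop, weight, add_mul] at hB
  set e : Expr := .lt (.reg i) (.reg b) with he_def
  set c' : Cmd := .seq c (.assign i (.add (.reg i) (.const 1))) with hc'_def
  -- Induction on the number `r` of remaining iterations.
  have key : ∀ r k : ℕ, k + r = s.reg b → ∀ s₁ : State, s₁.Bdd W → s₁.reg i = k →
      s₁.reg b = s.reg b → Inv k s₁ →
      ∃ s' t, Exec B (.loop e c') s₁ s' t ∧ t ≤ (e.time + 1) + r * (e.time + 1 + c'.timeBound) ∧
        s'.Bdd W ∧ Inv (s.reg b) s' := by
    intro r
    induction r with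
    | zero =>
      intro k hk s₁ hs₁ hki hkb hinv
      refine ⟨s₁, _, .loop_false (e.fits_of_weight (by omega) hs₁ (by omega)) ?_, by omega, hs₁, ?_⟩
      · simp [he_def, Expr.eval, hki, hkb]; omega
      · rw [← hk]; exact hinv
    | succ r ih =>
      intro k hk s₁ hs₁ hki hkb hinv
      have hsafe := safe_of_tame hW hc hs₁
      have hi' : (c.run s₁).reg i = k := by rw [run_reg_of_keepsReg hi, hki]
      have hb' : (c.run s₁).reg b = s.reg b := by rw [run_reg_of_keepsReg hb, hkb]
      have hkW : k + 1 ≤ W := by have := hs.1 b; omega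
      have hsafe' : c'.Safe W s₁ := ⟨hsafe, by simp [Safe, Expr.eval, hi', hkW]⟩
      have hlf : c'.loopFree = true := by
        simp [hc'_def, loopFree, loopFree_of_tame hc]
      obtain ⟨t₁, ht₁, h₁⟩ := exec_run (B := B) (by omega) hlf hs₁ hsafe'
        (by simp only [hc'_def, weight, add_mul]; omega)
      have hrun : c'.run s₁ = (c.run s₁).setReg i (k + 1) := by
        simp [hc'_def, run, Expr.eval, hi']
      rw [hrun] at h₁
      obtain ⟨s', t, hex, ht, hbd, hinv'⟩ := ih (k + 1) (by omega) _
        ((hsafe.bdd hs₁).setReg i hkW) (by simp) (by simp [hib, hb'])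
        (h_reg _ _ _ (h_step k s₁ (by omega) hki hinv))
      refine ⟨s', _, .loop_true (e.fits_of_weight (by omega) hs₁ (by omega)) ?_ h₁ hex, ?_,
        hbd, hinv'⟩
      · simp [he_def, Expr.eval, hki, hkb]; omega
      · rw [add_mul, one_mul]; omega
  obtain ⟨s', t, hex, ht, hbd, hinv⟩ := key (s.reg b) 0 (by omega) (s.setReg i 0)
    (hs.setReg i (by omega)) (by simp) (by simp [hib]) (h_reg _ _ _ h0)
  refine ⟨s', _, .seq (.assign i (.const 0) s (Expr.fits_of_weight (by omega) hs _ (by omega))) hex,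
    ?_, hbd, hinv⟩
  -- The longest loop visits `4 * nU` darts; this is the factor 4 in `timeBound`.
  have h1 : s.reg b * (e.time + 1 + c'.timeBound) ≤ 4 * m * (e.time + 1 + c'.timeBound) :=
    Nat.mul_le_mul_right _ hm
  have h2 : Expr.time (.const 0) = 1 := rfl
  simp only [forLoop, timeBound, ← he_def, ← hc'_def] at h1 ⊢
  rw [h2]
  nlinarith

/-- Store the values `v p` in the cells `a p` of bank `b`, for all `p` in the list. -/
def storeAll {α : Type} (b : ℕ) (a v : α → Expr) : List α → Cmd
  | [] => .skip
  | p :: l => .seq (.store b (a p) (v p)) (storeAll b a v l)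

theorem storeAll_keepsReg {α : Type} (b : ℕ) (a v : α → Expr) (r : ℕ) :
    ∀ l, (storeAll b a v l).keepsReg r = true
  | [] => rfl
  | _ :: l => by simp [storeAll, keepsReg, storeAll_keepsReg b a v r l]

theorem storeAll_keepsBank {α : Type} {b b' : ℕ} (hb : b' ≠ b) (a v : α → Expr) :
    ∀ l, (storeAll b a v l).keepsBank b' = true
  | [] => rfl
  | _ :: l => by simp [storeAll, keepsBank, storeAll_keepsBank hb a v l, hb]

/-- If the addresses and values do not depend on the cells that are written, then the stores act
simultaneously. -/
theorem run_storeAll {α : Type} {b : ℕ} {a v : α → Expr} {l : List α} {s : State}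
    (A V : α → ℕ) (hA : ∀ p ∈ l, ∀ q ∈ l, A p = A q → p = q)
    (h : ∀ s' : State, s'.reg = s.reg → (∀ b' ≠ b, s'.mem b' = s.mem b') →
      (∀ x, (∀ p ∈ l, x ≠ A p) → s'.mem b x = s.mem b x) →
      ∀ p ∈ l, (a p).eval s' = A p ∧ (v p).eval s' = V p) :
    (∀ p ∈ l, ((storeAll b a v l).run s).mem b (A p) = V p) ∧
      ∀ x, (∀ p ∈ l, x ≠ A p) → ((storeAll b a v l).run s).mem b x = s.mem b x := by
  induction l generalizing s with
  | nil => simp [storeAll, run]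
  | cons p l ih =>
    obtain ⟨ha, hv⟩ := h s rfl (fun _ _ => rfl) (fun _ _ => rfl) p (by simp)
    have hs₁ : ((Cmd.store b (a p) (v p)).run s) = s.setMem b (A p) (V p) := by
      simp [run, ha, hv]
    have hrun : (storeAll b a v (p :: l)).run s
        = (storeAll b a v l).run (s.setMem b (A p) (V p)) := by
      rw [storeAll, run, hs₁]
    obtain ⟨ih₁, ih₂⟩ := ih (s := s.setMem b (A p) (V p))
      (fun p hp q hq => hA p (by simp [hp]) q (by simp [hq])) (by
        intro s' hr hm hx q hq
        refine h s' (by rw [hr]; rfl) (fun b' hb' => ?_) (fun x hx' => ?_) q (by simp [hq])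
        · rw [hm b' hb']; funext x; simp [hb']
        · rw [hx x (fun q hq => hx' q (by simp [hq]))]
          simp [hx' p (by simp)])
    rw [hrun]
    refine ⟨fun q hq => ?_, fun x hx => ?_⟩
    · by_cases hql : q ∈ l
      · exact ih₁ q hql
      · obtain rfl : q = p := by simpa [hql] using hq
        -- By injectivity of the addresses, no later store hits this cell.
        rw [ih₂ (A q) (fun r hr he => hql (hA q (by simp) r (by simp [hr]) he ▸ hr))]
        simp
    · rw [ih₂ x (fun q hq => hx q (by simp [hq]))]
      simp [hx p (by simp)]

end Cmd

end RAM

/-! ### Elimination of variables -/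

namespace Elimination

/-- The links of the darts `2 * k, …, 4 * N - 1` form an involution `m` without fixed points among
the darts below `2 * N`, and the tables `T` at the two ends of a link agree. -/
structure Linked (N k : ℕ) (m : ℕ → ℕ) (T : ℕ → ℕ → ℕ → ℕ) : Prop where
  lt : ∀ d, 2 * k ≤ d → d < 4 * N → m d < 4 * N
  ge : ∀ d, 2 * k ≤ d → d < 4 * N → 2 * k ≤ m d
  inv : ∀ d, 2 * k ≤ d → d < 4 * N → m (m d) = d
  ne : ∀ d, 2 * k ≤ d → d < 2 * N → m d ≠ d
  symm : ∀ d, 2 * k ≤ d → d < 4 * N → ∀ i < 3, ∀ j < 3, T (m d) i j = T d j i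

/-- Assignments of one of three states to the darts: the two darts of a node have the same state,
and the other darts have state `0`. -/
structure Assignment (N : ℕ) (X : ℕ → ℕ) : Prop where
  lt : ∀ d, X d < 3
  node : ∀ u < N, X (2 * u + 1) = X (2 * u)
  dummy : ∀ d, 2 * N ≤ d → X d = 0

/-- Twice the total cost of the links among the darts `2 * k, …, 4 * N - 1`. -/
def total (N k : ℕ) (m : ℕ → ℕ) (T : ℕ → ℕ → ℕ → ℕ) (X : ℕ → ℕ) : ℕ :=
  ∑ d ∈ Finset.Ico (2 * k) (4 * N), T d (X d) (X (m d))

/-- The cost of the links at node `u` if its state is `j`. -/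
def nodeCost (m : ℕ → ℕ) (T : ℕ → ℕ → ℕ → ℕ) (X : ℕ → ℕ) (u j : ℕ) : ℕ :=
  if m (2 * u) = 2 * u + 1 then T (2 * u) j j
  else T (2 * u) j (X (m (2 * u))) + T (2 * u + 1) j (X (m (2 * u + 1)))

/-- The states of the first `k` nodes are locally optimal. -/
def LocallyOptimal (k : ℕ) (m : ℕ → ℕ) (T : ℕ → ℕ → ℕ → ℕ) (X : ℕ → ℕ) : Prop :=
  ∀ u < k, ∀ j < 3, nodeCost m T X u (X (2 * u)) ≤ nodeCost m T X u j

/-- The cost of an optimal state for an eliminated node, given the states of its neighbours. -/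
def bestCost (C : ℕ) (T : ℕ → ℕ → ℕ → ℕ) (d e i l : ℕ) : ℕ :=
  min C (min (T d 0 i + T e 0 l) (min (T d 1 i + T e 1 l) (T d 2 i + T e 2 l)))

/-- The links `m'` and tables `T'` result from the elimination of node `k`. -/
structure Step (C N k : ℕ) (m m' : ℕ → ℕ) (T T' : ℕ → ℕ → ℕ → ℕ) : Prop where
  loop : m (2 * k) = 2 * k + 1 → m' = m ∧ T' = T
  left : m (2 * k) ≠ 2 * k + 1 → m' (m (2 * k)) = m (2 * k + 1)
  right : m (2 * k) ≠ 2 * k + 1 → m' (m (2 * k + 1)) = m (2 * k)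
  left_table : m (2 * k) ≠ 2 * k + 1 → ∀ i < 3, ∀ l < 3,
    T' (m (2 * k)) i l = bestCost C T (2 * k) (2 * k + 1) i l
  right_table : m (2 * k) ≠ 2 * k + 1 → ∀ i < 3, ∀ l < 3,
    T' (m (2 * k + 1)) l i = bestCost C T (2 * k) (2 * k + 1) i l
  other : ∀ d, d ≠ m (2 * k) → d ≠ m (2 * k + 1) → m' d = m d
  other_table : ∀ d, d ≠ m (2 * k) → d ≠ m (2 * k + 1) → ∀ i < 3, ∀ l < 3, T' d i l = T d i l

/-- The elimination of the first `k` nodes has preserved the capped costs `G`. -/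
structure Preserves (C N k : ℕ) (G : (ℕ → ℕ) → ℕ) (m : ℕ → ℕ) (T : ℕ → ℕ → ℕ → ℕ) : Prop where
  linked : Linked N k m T
  cost : ∃ K, ∀ X, Assignment N X → min C (K + total N k m T X) ≤ G X ∧
    (LocallyOptimal k m T X → G X ≤ min C (K + total N k m T X))

/-! ### The effect of eliminating one node -/

variable {C N k : ℕ} {m m' : ℕ → ℕ} {T T' : ℕ → ℕ → ℕ → ℕ} {G : (ℕ → ℕ) → ℕ}

theorem bestCost_le (C : ℕ) (T : ℕ → ℕ → ℕ → ℕ) (d e i l : ℕ) {j : ℕ} (hj : j < 3) :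
    bestCost C T d e i l ≤ T d j i + T e j l := by
  unfold bestCost
  interval_cases j <;> omega

theorem le_bestCost (C : ℕ) (T : ℕ → ℕ → ℕ → ℕ) (d e i l : ℕ) {x : ℕ}
    (h : ∀ j < 3, x ≤ T d j i + T e j l) : min C x ≤ bestCost C T d e i l := by
  have h0 := h 0 (by omega)
  have h1 := h 1 (by omega)
  have h2 := h 2 (by omega)
  unfold bestCost
  omega

/-- Unless the two darts of the node are mates of each other, an involution without fixed points on
node darts sends them to two distinct darts outside the node. These are the ends that can be spliced
together. -/
theorem Linked.neighbours (h : Linked N k m T) (hk : k < N) (hl : m (2 * k) ≠ 2 * k + 1) :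
    2 * (k + 1) ≤ m (2 * k) ∧ 2 * (k + 1) ≤ m (2 * k + 1) ∧ m (2 * k) < 4 * N ∧
      m (2 * k + 1) < 4 * N ∧ m (2 * k) ≠ m (2 * k + 1) := by
  have h0 := h.ge (2 * k) (by omega) (by omega)
  have h1 := h.ge (2 * k + 1) (by omega) (by omega)
  have h2 := h.ne (2 * k) (by omega) (by omega)
  have h3 := h.ne (2 * k + 1) (by omega) (by omega)
  have h4 := h.inv (2 * k) (by omega) (by omega)
  have h5 := h.inv (2 * k + 1) (by omega) (by omega)
  have h6 : m (2 * k + 1) ≠ 2 * k := fun he => hl (by rw [he] at h5; exact h5)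
  have h7 : m (2 * k) ≠ m (2 * k + 1) := fun he => by rw [he, h5] at h4; omega
  exact ⟨by omega, by omega, h.lt _ (by omega) (by omega), h.lt _ (by omega) (by omega), h7⟩

theorem Linked.step (h : Linked N k m T) (hk : k < N) (hs : Step C N k m m' T T') :
    Linked N (k + 1) m' T' := by
  by_cases hl : m (2 * k) = 2 * k + 1
  · obtain ⟨rfl, rfl⟩ := hs.loop hl
    have hl' : m' (2 * k + 1) = 2 * k := by
      rw [← hl]; exact h.inv _ (by omega) (by omega)
    refine ⟨fun d h1 h2 => h.lt d (by omega) h2, fun d h1 h2 => ?_,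
      fun d h1 h2 => h.inv d (by omega) h2, fun d h1 h2 => h.ne d (by omega) h2,
      fun d h1 h2 => h.symm d (by omega) h2⟩
    have h3 := h.ge d (by omega) h2
    have h4 := h.inv d (by omega) h2
    have h5 : m' d ≠ 2 * k := fun he => by rw [he, hl] at h4; omega
    have h6 : m' d ≠ 2 * k + 1 := fun he => by rw [he, hl'] at h4; omega
    omega
  · obtain ⟨ha, hc, ha', hc', hac⟩ := h.neighbours hk hl
    have e0 := h.inv (2 * k) (by omega) (by omega)
    have e1 := h.inv (2 * k + 1) (by omega) (by omega)
    have hleft := hs.left hl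
    have hright := hs.right hl
    -- By injectivity, the surviving darts other than the two spliced ends are closed under `m`.
    have hrest : ∀ d, 2 * (k + 1) ≤ d → d < 4 * N → d ≠ m (2 * k) → d ≠ m (2 * k + 1) →
        2 * (k + 1) ≤ m d ∧ m d ≠ m (2 * k) ∧ m d ≠ m (2 * k + 1) := by
      intro d h1 h2 h3 h4
      have h5 := h.ge d (by omega) h2
      have h6 := h.inv d (by omega) h2
      have h7 : m d ≠ 2 * k := fun he => h3 (by rw [← he, h6])
      have h8 : m d ≠ 2 * k + 1 := fun he => h4 (by rw [← he, h6])
      refine ⟨by omega, fun he => ?_, fun he => ?_⟩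
      · rw [he, e0] at h6; omega
      · rw [he, e1] at h6; omega
    refine ⟨fun d h1 h2 => ?_, fun d h1 h2 => ?_, fun d h1 h2 => ?_, fun d h1 h2 => ?_,
      fun d h1 h2 i hi j hj => ?_⟩
    -- Each field is checked at the two spliced ends, where `Step` prescribes the new values, and
    -- then at the untouched darts.
    all_goals
      by_cases hda : d = m (2 * k)
      · subst hda
        first
          | rw [hleft]; assumption
          | rw [hleft, hright]
          | rw [hleft]; exact hac.symm
          | rw [hleft, hs.right_table hl j hj i hi, hs.left_table hl j hj i hi]
      by_cases hdc : d = m (2 * k + 1)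
      · subst hdc
        first
          | rw [hright]; assumption
          | rw [hright, hleft]
          | rw [hright, hs.right_table hl i hi j hj, hs.left_table hl i hi j hj]
      obtain ⟨h3, h4, h5⟩ := hrest d h1 (by omega) hda hdc
      rw [hs.other d hda hdc]
    · exact h.lt d (by omega) h2
    · exact h3
    · rw [hs.other _ h4 h5]; exact h.inv d (by omega) h2
    · exact h.ne d (by omega) h2
    · rw [hs.other_table _ h4 h5 i hi j hj, hs.other_table _ hda hdc j hj i hi]
      exact h.symm d (by omega) h2 i hi j hj

theorem total_split (hk : k < N) (X : ℕ → ℕ) :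
    total N k m T X = T (2 * k) (X (2 * k)) (X (m (2 * k))) +
      (T (2 * k + 1) (X (2 * k + 1)) (X (m (2 * k + 1))) + total N (k + 1) m T X) := by
  unfold total
  rw [Finset.sum_eq_sum_Ico_succ_bot (by omega), Finset.sum_eq_sum_Ico_succ_bot (by omega)]
  rfl

theorem total_split_pair {a c : ℕ} (ha : 2 * k ≤ a) (ha' : a < 4 * N) (hc : 2 * k ≤ c)
    (hc' : c < 4 * N) (hac : a ≠ c) (X : ℕ → ℕ) :
    total N k m T X = T a (X a) (X (m a)) + (T c (X c) (X (m c)) +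
      ∑ d ∈ ((Finset.Ico (2 * k) (4 * N)).erase a).erase c, T d (X d) (X (m d))) := by
  unfold total
  rw [Finset.add_sum_erase _ (fun d => T d (X d) (X (m d))),
    Finset.add_sum_erase _ (fun d => T d (X d) (X (m d)))]
  · simp [ha, ha']
  · simp [hac.symm, hc, hc']

/-- The link of the node with itself is seen from both darts, and by symmetry both see the same
diagonal entry. -/
theorem total_loop (h : Linked N k m T) (hk : k < N) (hl : m (2 * k) = 2 * k + 1) {X : ℕ → ℕ}
    (hX : Assignment N X) :
    total N k m T X = 2 * nodeCost m T X k (X (2 * k)) + total N (k + 1) m T X := by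
  have hl' : m (2 * k + 1) = 2 * k := by
    rw [← hl]; exact h.inv _ (by omega) (by omega)
  have hs := h.symm (2 * k) (by omega) (by omega) (X (2 * k)) (hX.lt _) (X (2 * k)) (hX.lt _)
  rw [hl] at hs
  rw [total_split hk, nodeCost, if_pos hl, hl, hl', hX.node k hk, hs]
  ring

/-- The node's two darts and their mates contribute its cost twice, by symmetry of the tables. After
splicing, the two ends contribute the optimal cost twice. The common rest `R` comes from the other
darts. -/
theorem total_step (h : Linked N k m T) (hk : k < N) (hs : Step C N k m m' T T')
    (hl : m (2 * k) ≠ 2 * k + 1) {X : ℕ → ℕ} (hX : Assignment N X) :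
    ∃ R, total N k m T X = 2 * nodeCost m T X k (X (2 * k)) + R ∧
      total N (k + 1) m' T' X
        = 2 * bestCost C T (2 * k) (2 * k + 1) (X (m (2 * k))) (X (m (2 * k + 1))) + R := by
  obtain ⟨ha, hc, ha', hc', hac⟩ := h.neighbours hk hl
  refine ⟨∑ d ∈ ((Finset.Ico (2 * (k + 1)) (4 * N)).erase (m (2 * k))).erase (m (2 * k + 1)),
    T d (X d) (X (m d)), ?_, ?_⟩
  · rw [total_split hk, total_split_pair ha ha' hc hc' hac, h.inv _ (by omega) (by omega),
      h.inv _ (by omega) (by omega), h.symm _ (by omega) (by omega) _ (hX.lt _) _ (hX.lt _),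
      h.symm _ (by omega) (by omega) _ (hX.lt _) _ (hX.lt _), nodeCost, if_neg hl, hX.node k hk]
    ring
  · rw [total_split_pair ha ha' hc hc' hac, hs.left hl, hs.right hl,
      hs.left_table hl _ (hX.lt _) _ (hX.lt _), hs.right_table hl _ (hX.lt _) _ (hX.lt _),
      ← add_assoc, ← two_mul]
    congr 1
    refine Finset.sum_congr rfl fun d hd => ?_
    simp only [Finset.mem_erase] at hd
    rw [hs.other d hd.2.1 hd.1, hs.other_table d hd.2.1 hd.1 _ (hX.lt _) _ (hX.lt _)]

/-- An elimination writes only at darts of later nodes or dummies, so the cost at an eliminated node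
is frozen, including that of node `k` itself. Hence local optimality can be judged with the final
links and tables. -/
theorem nodeCost_step (h : Linked N k m T) (hk : k < N) (hs : Step C N k m m' T T') {X : ℕ → ℕ}
    (hX : Assignment N X) {u j : ℕ} (hu : u ≤ k) (hj : j < 3) :
    nodeCost m' T' X u j = nodeCost m T X u j := by
  by_cases hl : m (2 * k) = 2 * k + 1
  · obtain ⟨rfl, rfl⟩ := hs.loop hl; rfl
  · obtain ⟨ha, hc, -, -, -⟩ := h.neighbours hk hl
    unfold nodeCost
    rw [hs.other (2 * u) (by omega) (by omega), hs.other (2 * u + 1) (by omega) (by omega),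
      hs.other_table (2 * u) (by omega) (by omega) j hj j hj,
      hs.other_table (2 * u) (by omega) (by omega) j hj _ (hX.lt _),
      hs.other_table (2 * u + 1) (by omega) (by omega) j hj _ (hX.lt _)]

/-- Replacing the cost of a node by the minimum over its states can only lower the sum, and does not
lower it if the state is already optimal. The cap inside `bestCost` is invisible because only sums
capped at the same `C` are compared. -/
theorem Preserves.step (h : Preserves C N k G m T) (hk : k < N) (hs : Step C N k m m' T T') :
    Preserves C N (k + 1) G m' T' := by
  obtain ⟨hlink, K, hK⟩ := h
  have hopt : ∀ {X}, Assignment N X → LocallyOptimal (k + 1) m' T' X →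
      LocallyOptimal k m T X ∧ ∀ j < 3, nodeCost m T X k (X (2 * k)) ≤ nodeCost m T X k j := by
    intro X hX hloc
    refine ⟨fun u hu j hj => ?_, fun j hj => ?_⟩
    · have := hloc u (by omega) j hj
      rwa [nodeCost_step hlink hk hs hX (by omega) (hX.lt _),
        nodeCost_step hlink hk hs hX (by omega) hj] at this
    · have := hloc k (by omega) j hj
      rwa [nodeCost_step hlink hk hs hX le_rfl (hX.lt _),
        nodeCost_step hlink hk hs hX le_rfl hj] at this
  refine ⟨hlink.step hk hs, ?_⟩
  by_cases hl : m (2 * k) = 2 * k + 1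
  -- A contracted cycle no longer interacts with other nodes, so its minimum moves into the
  -- constant; the factor 2 is the double counting in `total`.
  · refine ⟨K + 2 * min (T (2 * k) 0 0) (min (T (2 * k) 1 1) (T (2 * k) 2 2)), fun X hX => ?_⟩
    obtain ⟨h1, h2⟩ := hK X hX
    have ht := total_loop hlink hk hl hX
    have hn : ∀ j, nodeCost m T X k j = T (2 * k) j j := fun j => by rw [nodeCost, if_pos hl]
    have ho := @hopt X hX
    obtain ⟨rfl, rfl⟩ := hs.loop hl
    refine ⟨?_, fun hloc => ?_⟩
    · have hx := hX.lt (2 * k)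
      have : min (T' (2 * k) 0 0) (min (T' (2 * k) 1 1) (T' (2 * k) 2 2))
          ≤ nodeCost m' T' X k (X (2 * k)) := by
        rw [hn]
        generalize X (2 * k) = j at hx
        interval_cases j <;> omega
      omega
    · obtain ⟨ho1, ho2⟩ := ho hloc
      have h0 := ho2 0 (by omega)
      have h1 := ho2 1 (by omega)
      have h2' := ho2 2 (by omega)
      have h3 := h2 ho1
      rw [hn 0] at h0
      rw [hn 1] at h1
      rw [hn 2] at h2'
      omega
  · refine ⟨K, fun X hX => ?_⟩
    obtain ⟨h1, h2⟩ := hK X hX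
    obtain ⟨R, hR, hR'⟩ := total_step hlink hk hs hl hX
    have hn : ∀ j, nodeCost m T X k j
        = T (2 * k) j (X (m (2 * k))) + T (2 * k + 1) j (X (m (2 * k + 1))) := fun j => by
      rw [nodeCost, if_neg hl]
    refine ⟨?_, fun hloc => ?_⟩
    · have := bestCost_le C T (2 * k) (2 * k + 1) (X (m (2 * k))) (X (m (2 * k + 1)))
        (hX.lt (2 * k))
      rw [← hn] at this
      omega
    · obtain ⟨ho1, ho2⟩ := hopt hX hloc
      have h3 := h2 ho1
      have := le_bestCost C T (2 * k) (2 * k + 1) (X (m (2 * k))) (X (m (2 * k + 1)))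
        (x := nodeCost m T X k (X (2 * k))) (fun j hj => by rw [← hn]; exact ho2 j hj)
      omega

/-- Agreement on genuine darts and states suffices; the memory cells beyond them are unspecified. -/
theorem Preserves.zero (h : Linked N 0 m T) (hm : ∀ d < 4 * N, m' d = m d)
    (hT : ∀ d < 4 * N, ∀ i < 3, ∀ j < 3, T' d i j = T d i j) :
    Preserves C N 0 (fun X => min C (total N 0 m T X)) m' T' := by
  refine ⟨⟨fun d h1 h2 => ?_, fun _ _ _ => by omega, fun d h1 h2 => ?_, fun d h1 h2 => ?_,
    fun d h1 h2 i hi j hj => ?_⟩, 0, fun X hX => ?_⟩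
  · rw [hm d h2]; exact h.lt d h1 h2
  · rw [hm d h2, hm _ (h.lt d h1 h2)]; exact h.inv d h1 h2
  · rw [hm d (by omega)]; exact h.ne d h1 h2
  · rw [hm d h2, hT _ (h.lt d h1 h2) i hi j hj, hT d h2 j hj i hi]; exact h.symm d h1 h2 i hi j hj
  · have : total N 0 m' T' X = total N 0 m T X := by
      refine Finset.sum_congr rfl fun d hd => ?_
      have hd' := (Finset.mem_Ico.1 hd).2
      rw [hm d hd', hT d hd' _ (hX.lt _) _ (hX.lt _)]
    simp [this]

/-- The neighbours of each of the first `k` nodes at its elimination were later nodes. -/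
def Retired (k : ℕ) (m : ℕ → ℕ) : Prop :=
  ∀ u < k, m (2 * u) = 2 * u + 1 ∨ (2 * (u + 1) ≤ m (2 * u) ∧ 2 * (u + 1) ≤ m (2 * u + 1))

/-- This orientation towards later nodes is what makes choosing states in reverse order possible. -/
theorem Retired.step (hr : Retired k m) (h : Linked N k m T) (hk : k < N)
    (hs : Step C N k m m' T T') : Retired (k + 1) m' := by
  intro u hu
  by_cases hl : m (2 * k) = 2 * k + 1
  · obtain ⟨rfl, -⟩ := hs.loop hl
    obtain hu | rfl : u < k ∨ u = k := by omega
    · exact hr u hu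
    · exact Or.inl hl
  · obtain ⟨ha, hc, -, -, -⟩ := h.neighbours hk hl
    rw [hs.other (2 * u) (by omega) (by omega), hs.other (2 * u + 1) (by omega) (by omega)]
    obtain hu | rfl : u < k ∨ u = k := by omega
    · exact hr u hu
    · exact Or.inr ⟨ha, hc⟩

/-- After the elimination of all nodes, a locally optimal assignment is optimal. -/
theorem Preserves.optimal (h : Preserves C N N G m T) {X Y : ℕ → ℕ} (hX : Assignment N X)
    (hY : Assignment N Y) (hloc : LocallyOptimal N m T X) : G X ≤ G Y := by
  obtain ⟨hlink, K, hK⟩ := h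
  -- Only links among dummies are left, and dummies always have state 0.
  have : total N N m T X = total N N m T Y := by
    refine Finset.sum_congr rfl fun d hd => ?_
    rw [Finset.mem_Ico] at hd
    have := hlink.ge d hd.1 hd.2
    rw [hX.dummy d hd.1, hY.dummy d hd.1, hX.dummy _ this, hY.dummy _ this]
  exact ((hK X hX).2 hloc).trans (this ▸ (hK Y hY).1)

/-- This allows every table entry to be capped without affecting the capped objective. -/
theorem min_sum_min {ι : Type*} (C : ℕ) (f : ι → ℕ) (S : Finset ι) :
    min C (∑ d ∈ S, min C (f d)) = min C (∑ d ∈ S, f d) := by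
  classical
  induction S using Finset.induction_on with
  | empty => rfl
  | insert a S ha ih => rw [Finset.sum_insert ha, Finset.sum_insert ha]; omega

end Elimination

namespace RestrictedSM

open Elimination

variable (I : RestrictedSM)

/-! ### The darts of an instance -/

/-- The dart of man `u` for woman `w`. -/
def dart (u : Fin I.nU) (w : Fin I.nW) : ℕ := 2 * u + (I.prefU u).idxOf w

/-- The edge of a dart. -/
def edgeAt (d : ℕ) : Option (Fin I.nU × Fin I.nW) :=
  if h : d / 2 < I.nU then (I.prefU ⟨d / 2, h⟩)[d % 2]?.map fun w => (⟨d / 2, h⟩, w) else none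

/-- The other man on the list of woman `w`. -/
def rival (u : Fin I.nU) (w : Fin I.nW) : Option (Fin I.nU) :=
  ((I.prefW w).filter (· ≠ u)).head?

/-- The dart of the other man at the same woman, or a dummy dart. -/
def manMate (d : ℕ) : ℕ :=
  match I.edgeAt d with
  | none => 2 * I.nU + d
  | some (u, w) =>
    match I.rival u w with
    | none => 2 * I.nU + d
    | some u' => I.dart u' w

/-- The links among the darts of the men and the dummy darts. -/
def mate (d : ℕ) : ℕ :=
  if d < 2 * I.nU then I.manMate d
  else if I.manMate (d - 2 * I.nU) = d then d - 2 * I.nU else d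

/-- The penalty for the violation of a constraint. -/
def penalty : ℕ := 2 * I.nU + 1

/-- The bound at which costs are capped. -/
def cap : ℕ := 4 * I.nU + 2

/-- The cost of an edge with label `a` in position `s` of the man's list and position `r` of the
woman's list, where the man is in state `j`, and the woman's other man has her in position `s'` and
is in state `i`. -/
def stateCost (a r s' s j i : ℕ) : ℕ :=
  if j = s + 1 then if i = s' + 1 ∨ a = 1 then I.penalty else 0
  else min I.cap ((if a = 2 then I.penalty else 0) +
    if (j = 0 ∨ s + 1 < j) ∧ ¬ (i = s' + 1 ∧ r = 1) then 1 else 0)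

/-- The position of woman `w` on the list of her other man. -/
def rivalSlot (u : Fin I.nU) (w : Fin I.nW) : ℕ :=
  match I.rival u w with
  | none => 0
  | some u' => (I.prefU u').idxOf w

/-- The cost of the edge of a dart in state `j` with mate in state `i`. -/
def dartCost (d j i : ℕ) : ℕ :=
  match I.edgeAt d with
  | none => 0
  | some (u, w) =>
    I.stateCost (I.label u w) ((I.prefW w).idxOf u) (I.rivalSlot u w) (d % 2) j i

/-- The initial cost tables of the links. -/
def linkCost (d j i : ℕ) : ℕ := min I.cap (I.dartCost d j i + I.dartCost (I.mate d) i j)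

/-- The matching described by an assignment of states. -/
def matchingOf (X : ℕ → ℕ) : Finset (Fin I.nU × Fin I.nW) :=
  I.edges.filter fun e => X (2 * e.1) = (I.prefU e.1).idxOf e.2 + 1

/-! ### Decoding darts and the involution of mates -/

variable {I}

theorem mem_edges {e : Fin I.nU × Fin I.nW} : e ∈ I.edges ↔ e.2 ∈ I.prefU e.1 := by
  simp [edges]

theorem edgeAt_eq_some {d : ℕ} {u : Fin I.nU} {w : Fin I.nW} :
    I.edgeAt d = some (u, w) ↔ d / 2 = u ∧ (I.prefU u)[d % 2]? = some w := by
  unfold edgeAt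
  split_ifs with h
  · simp only [Option.map_eq_some_iff, Prod.mk.injEq]
    constructor
    · rintro ⟨w', h1, rfl, rfl⟩; exact ⟨rfl, h1⟩
    · rintro ⟨h1, h2⟩
      obtain rfl : u = ⟨d / 2, h⟩ := Fin.ext h1.symm
      exact ⟨w, h2, rfl, rfl⟩
  · simp only [false_iff, not_and]
    intro h1; have := u.2; omega

theorem edgeAt_of_lt {d : ℕ} {u : Fin I.nU} {w : Fin I.nW} (h : I.edgeAt d = some (u, w)) :
    d < 2 * I.nU ∧ w ∈ I.prefU u ∧ d = I.dart u w ∧ d % 2 = (I.prefU u).idxOf w := by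
  obtain ⟨h1, h2⟩ := edgeAt_eq_some.1 h
  have h3 := u.2
  obtain ⟨h4, h5⟩ := List.getElem?_eq_some_iff.1 h2
  have h6 : d % 2 = (I.prefU u).idxOf w := by
    rw [← h5, (I.nodupU u).idxOf_getElem]
  exact ⟨by omega, List.mem_of_getElem? h2, by unfold dart; omega, h6⟩

theorem idxOf_lt_two (hI : I.ListsBoundedBy 2) {u : Fin I.nU} {w : Fin I.nW}
    (h : w ∈ I.prefU u) : (I.prefU u).idxOf w < 2 :=
  (List.idxOf_lt_length_iff.2 h).trans_le (hI.1 u)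

theorem idxOf_lt_two' (hI : I.ListsBoundedBy 2) {u : Fin I.nU} {w : Fin I.nW}
    (h : u ∈ I.prefW w) : (I.prefW w).idxOf u < 2 :=
  (List.idxOf_lt_length_iff.2 h).trans_le (hI.2 w)

/-- List positions are 0 or 1, so quotient and remainder by 2 recover man and position from the
dart. -/
theorem edgeAt_dart (hI : I.ListsBoundedBy 2) {u : Fin I.nU} {w : Fin I.nW}
    (h : w ∈ I.prefU u) : I.edgeAt (I.dart u w) = some (u, w) := by
  have := idxOf_lt_two hI h
  have h1 : I.dart u w % 2 = (I.prefU u).idxOf w := by unfold dart; omega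
  refine edgeAt_eq_some.2 ⟨by unfold dart; omega, ?_⟩
  rw [h1, List.getElem?_eq_getElem (List.idxOf_lt_length_iff.2 h), List.getElem_idxOf]

/-- Once `u` is removed from a list of at most two men, at most one man remains. -/
theorem rival_eq_some (hI : I.ListsBoundedBy 2) {u u' : Fin I.nU} {w : Fin I.nW}
    (h : w ∈ I.prefU u) : I.rival u w = some u' ↔ w ∈ I.prefU u' ∧ u' ≠ u := by
  have h1 := hI.2 w
  have h2 := I.nodupW w
  rw [I.mutual_acceptable] at h ⊢
  unfold rival
  match hl : I.prefW w, h1, h2 with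
  | [], _, _ => simp [hl] at h
  | [a], _, _ =>
    simp only [hl, List.mem_singleton] at h
    subst h
    simp
  | [a, b], _, h2 =>
    simp only [hl, List.mem_cons, List.not_mem_nil, or_false] at h
    have hab : a ≠ b := by simpa using h2
    rcases h with rfl | rfl
    · simp [hab.symm]; grind
    · simp [hab]; grind

theorem manMate_of_rival {d : ℕ} {u u' : Fin I.nU} {w : Fin I.nW} (h : I.edgeAt d = some (u, w))
    (h' : I.rival u w = some u') : I.manMate d = I.dart u' w := by
  simp [manMate, h, h']

/-- Being rivals at a woman is symmetric, so darts that are not sent to their dummies are exchanged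
in pairs. -/
theorem manMate_cases (hI : I.ListsBoundedBy 2) (d : ℕ) :
    I.manMate d = 2 * I.nU + d ∨
      (I.manMate d < 2 * I.nU ∧ I.manMate (I.manMate d) = d ∧ I.manMate d ≠ d) := by
  cases he : I.edgeAt d with
  | none => left; simp [manMate, he]
  | some e =>
    obtain ⟨u, w⟩ := e
    obtain ⟨h1, h2, h3, h4⟩ := edgeAt_of_lt he
    cases hr : I.rival u w with
    | none => left; simp [manMate, he, hr]
    | some u' =>
      right
      have hm := manMate_of_rival he hr
      obtain ⟨h5, h6⟩ := (rival_eq_some hI h2).1 hr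
      have h7 := edgeAt_dart hI h5
      have h8 : I.rival u' w = some u := (rival_eq_some hI h5).2 ⟨h2, h6.symm⟩
      rw [hm, manMate_of_rival h7 h8, ← h3]
      refine ⟨(edgeAt_of_lt h7).1, rfl, fun he' => ?_⟩
      rw [he', he] at h7
      simp only [Option.some.injEq, Prod.mk.injEq] at h7
      exact h6 h7.1.symm

theorem mate_lt (hI : I.ListsBoundedBy 2) {d : ℕ} (hd : d < 4 * I.nU) : I.mate d < 4 * I.nU := by
  unfold mate
  rcases manMate_cases hI d with h | h <;> split_ifs <;> omega

/-- A dummy is paired with its dart if that dart has no rival, and is a fixed point otherwise. -/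
theorem mate_mate (hI : I.ListsBoundedBy 2) {d : ℕ} (hd : d < 4 * I.nU) :
    I.mate (I.mate d) = d := by
  by_cases h : d < 2 * I.nU
  · rw [show I.mate d = I.manMate d from if_pos h]
    rcases manMate_cases hI d with h1 | ⟨h1, h2, h3⟩
    · rw [h1, mate, if_neg (by omega), show 2 * I.nU + d - 2 * I.nU = d by omega, if_pos h1]
    · rw [mate, if_pos h1, h2]
  · by_cases h1 : I.manMate (d - 2 * I.nU) = d
    · rw [show I.mate d = d - 2 * I.nU by rw [mate, if_neg h, if_pos h1], mate,
        if_pos (by omega), h1]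
    · have h2 : I.mate d = d := by rw [mate, if_neg h, if_neg h1]
      rw [h2, h2]

theorem linked (hI : I.ListsBoundedBy 2) : Linked I.nU 0 I.mate I.linkCost where
  lt _ _ hd := mate_lt hI hd
  ge _ _ _ := by omega
  inv _ _ hd := mate_mate hI hd
  ne d _ hd := by
    rw [mate, if_pos hd]
    rcases manMate_cases hI d with h | h <;> omega
  symm d _ hd i _ j _ := by
    rw [linkCost, linkCost, mate_mate hI hd, add_comm]

/-! ### Assignments and matchings -/

variable {X : ℕ → ℕ}

theorem mem_matchingOf {u : Fin I.nU} {w : Fin I.nW} :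
    (u, w) ∈ I.matchingOf X ↔ w ∈ I.prefU u ∧ X (2 * u) = (I.prefU u).idxOf w + 1 := by
  simp [matchingOf, edges]

theorem assignment_dart (hI : I.ListsBoundedBy 2) (hX : Assignment I.nU X) {u : Fin I.nU}
    {w : Fin I.nW} (h : w ∈ I.prefU u) : X (I.dart u w) = X (2 * u) := by
  have h1 := idxOf_lt_two hI h
  have h2 := hX.node u u.2
  unfold dart
  generalize (I.prefU u).idxOf w = s at h1
  interval_cases s
  · rfl
  · exact h2

theorem rival_state (hI : I.ListsBoundedBy 2) (hX : Assignment I.nU X) {u : Fin I.nU}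
    {w : Fin I.nW} (h : w ∈ I.prefU u) :
    X (I.mate (I.dart u w)) = I.rivalSlot u w + 1 ↔ ∃ u' ≠ u, (u', w) ∈ I.matchingOf X := by
  have h1 := edgeAt_dart hI h
  rw [mate, if_pos (edgeAt_of_lt h1).1]
  cases hr : I.rival u w with
  | none =>
    have h2 : I.manMate (I.dart u w) = 2 * I.nU + I.dart u w := by simp [manMate, h1, hr]
    -- Without a rival, the default slot 0 is harmless: the dummy has state 0, never `0 + 1`.
    rw [h2, hX.dummy _ (by omega)]
    simp only [rivalSlot, hr]
    refine ⟨fun h => by omega, ?_⟩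
    rintro ⟨u', h3, h4⟩
    rw [(rival_eq_some hI h).2 ⟨(mem_matchingOf.1 h4).1, h3⟩] at hr
    simp at hr
  | some u' =>
    obtain ⟨h2, h3⟩ := (rival_eq_some hI h).1 hr
    rw [manMate_of_rival h1 hr, assignment_dart hI hX h2]
    simp only [rivalSlot, hr]
    refine ⟨fun h4 => ⟨u', h3, mem_matchingOf.2 ⟨h2, h4⟩⟩, ?_⟩
    rintro ⟨u'', h4, h5⟩
    rw [mem_matchingOf] at h5
    have h6 := (rival_eq_some hI h).2 ⟨h5.1, h4⟩
    rw [hr] at h6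
    obtain rfl : u' = u'' := by simpa using h6
    exact h5.2

theorem label_eq_one {u : Fin I.nU} {w : Fin I.nW} : I.label u w = 1 ↔ (u, w) ∈ I.P := by
  unfold label; split_ifs <;> simp_all

theorem label_eq_two {u : Fin I.nU} {w : Fin I.nW} : I.label u w = 2 ↔ (u, w) ∈ I.Q := by
  have := fun h : (u, w) ∈ I.P => Finset.disjoint_left.1 I.disjoint_PQ h
  unfold label; split_ifs <;> simp_all

/-- The man objects exactly if his state names an earlier entry of his list; a state pointing past
the end of the list counts as unmatched. The woman objects exactly if she has her other neighbour
and `u` comes second on her list. -/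
theorem blocks_matchingOf (hI : I.ListsBoundedBy 2) {u : Fin I.nU}
    {w : Fin I.nW} (h : w ∈ I.prefU u) (hM : X (2 * u) ≠ (I.prefU u).idxOf w + 1) :
    I.Blocks (I.matchingOf X) (u, w) ↔ (X (2 * u) = 0 ∨ (I.prefU u).idxOf w + 1 < X (2 * u)) ∧
      ¬ ((∃ u' ≠ u, (u', w) ∈ I.matchingOf X) ∧ (I.prefW w).idxOf u = 1) := by
  have hlt := List.idxOf_lt_length_iff.2 h
  have hw := (I.mutual_acceptable u w).1 h
  have hltw := idxOf_lt_two' hI hw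
  have hnot : (u, w) ∉ I.matchingOf X := fun h' => hM (mem_matchingOf.1 h').2
  unfold Blocks
  simp only [mem_edges, h, hnot, not_false_eq_true, true_and, ManPrefers, WomanPrefers]
  refine and_congr ⟨fun hb => ?_, fun hb w' hw' => ?_⟩ ⟨fun hb => ?_, fun hb u' hu' => ?_⟩
  · by_contra! hc
    -- A nonzero state smaller than that of `w` names a preferred actual partner, contradicting
    -- `hb`.
    have hlt' : X (2 * u) - 1 < (I.prefU u).length := by omega
    have hidx : (I.prefU u).idxOf (I.prefU u)[X (2 * u) - 1] = X (2 * u) - 1 :=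
      (I.nodupU u).idxOf_getElem _ _
    have := hb _ (mem_matchingOf.2 ⟨List.getElem_mem hlt', by rw [hidx]; omega⟩)
    rw [hidx] at this
    omega
  · rw [mem_matchingOf] at hw'; omega
  · rintro ⟨⟨u', h1, h2⟩, h3⟩
    have h4 := hb u' h2
    have h5 := idxOf_lt_two' hI ((I.mutual_acceptable u' w).1 (mem_matchingOf.1 h2).1)
    omega
  · have h1 : u' ≠ u := by rintro rfl; exact hnot hu'
    have h2 := (I.mutual_acceptable u' w).1 (mem_matchingOf.1 hu').1
    have h3 : (I.prefW w).idxOf u ≠ 1 := fun h3 => hb ⟨⟨u', h1, hu'⟩, h3⟩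
    have h4 : (I.prefW w).idxOf u' ≠ (I.prefW w).idxOf u := fun h4 =>
      h1 ((List.idxOf_inj h2).1 h4)
    omega

-- The local cost of a dart in terms of the matching: here the two-state rule is identified with
-- violated constraints and blocking edges.
open Classical in
theorem dartCost_dart (hI : I.ListsBoundedBy 2) (hX : Assignment I.nU X) {u : Fin I.nU}
    {w : Fin I.nW} (h : w ∈ I.prefU u) :
    I.dartCost (I.dart u w) (X (I.dart u w)) (X (I.mate (I.dart u w))) =
      if (u, w) ∈ I.matchingOf X then
        if (∃ u' ≠ u, (u', w) ∈ I.matchingOf X) ∨ (u, w) ∈ I.P then I.penalty else 0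
      else min I.cap ((if (u, w) ∈ I.Q then I.penalty else 0) +
        if I.Blocks (I.matchingOf X) (u, w) then 1 else 0) := by
  have h1 := edgeAt_dart hI h
  have hr := rival_state hI hX h
  have hb := fun h2 => blocks_matchingOf (X := X) hI h h2
  have hm : (u, w) ∈ I.matchingOf X ↔ X (2 * u) = (I.prefU u).idxOf w + 1 := by
    rw [mem_matchingOf]; exact and_iff_right h
  rw [← hr] at hb
  simp only [← hr, hm]
  simp only [dartCost, h1, stateCost, (edgeAt_of_lt h1).2.2.2, assignment_dart hI hX h,
    label_eq_one, label_eq_two]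
  by_cases h2 : X (2 * u) = (I.prefU u).idxOf w + 1
  · simp only [if_pos h2]
  · simp only [if_neg h2, hb h2]

/-- The sum of the costs of all edges. -/
def totalCost (I : RestrictedSM) (X : ℕ → ℕ) : ℕ :=
  ∑ e ∈ I.edges, I.dartCost (I.dart e.1 e.2) (X (I.dart e.1 e.2)) (X (I.mate (I.dart e.1 e.2)))

/-- Darts without an edge cost nothing; the others correspond bijectively to the edges. -/
theorem sum_dartCost (hI : I.ListsBoundedBy 2) (X : ℕ → ℕ) :
    ∑ d ∈ Finset.range (4 * I.nU), I.dartCost d (X d) (X (I.mate d)) = I.totalCost X := by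
  symm
  refine Finset.sum_bij_ne_zero (fun e _ _ => I.dart e.1 e.2) ?_ ?_ ?_ (fun _ _ _ => rfl)
  · intro e he _
    have := (edgeAt_of_lt (edgeAt_dart hI (mem_edges.1 he))).1
    simp only [Finset.mem_range]; omega
  · intro e he _ f hf _ hef
    have h1 := edgeAt_dart hI (mem_edges.1 he)
    rw [hef, edgeAt_dart hI (mem_edges.1 hf)] at h1
    exact (Option.some.inj h1).symm
  · intro d _ hne
    cases hd : I.edgeAt d with
    | none => simp [dartCost, hd] at hne
    | some e =>
      obtain ⟨h1, h2, h3, -⟩ := edgeAt_of_lt (u := e.1) (w := e.2) hd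
      exact ⟨e, mem_edges.2 h2, by rw [← h3]; exact hne, h3.symm⟩

/-- A link table adds the costs seen from both ends. Reindexing along the involution `mate` shows
that each dart is counted twice. -/
theorem min_total (hI : I.ListsBoundedBy 2) (X : ℕ → ℕ) :
    min I.cap (total I.nU 0 I.mate I.linkCost X) = min I.cap (2 * I.totalCost X) := by
  unfold total linkCost
  rw [min_sum_min, mul_zero, Nat.Ico_zero_eq_range, Finset.sum_add_distrib, sum_dartCost hI,
    two_mul, ← sum_dartCost hI X]
  congr 2
  refine Finset.sum_bij' (fun d _ => I.mate d) (fun d _ => I.mate d) ?_ ?_ ?_ ?_ ?_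
  · intro d hd; simp only [Finset.mem_range] at hd ⊢; exact mate_lt hI hd
  · intro d hd; simp only [Finset.mem_range] at hd ⊢; exact mate_lt hI hd
  · intro d hd; exact mate_mate hI (Finset.mem_range.1 hd)
  · intro d hd; exact mate_mate hI (Finset.mem_range.1 hd)
  · intro d hd; rw [mate_mate hI (Finset.mem_range.1 hd)]

/-- Edges inject into the darts of the men. The choice of `penalty` and `cap` rests on this bound.
-/
theorem card_edges_le (hI : I.ListsBoundedBy 2) : I.edges.card ≤ 2 * I.nU := by
  rw [← Finset.card_range (2 * I.nU)]
  refine Finset.card_le_card_of_injOn (fun e => I.dart e.1 e.2) ?_ ?_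
  · intro e he
    have := (edgeAt_of_lt (edgeAt_dart hI (mem_edges.1 he))).1
    simpa using this
  · intro e he f hf hef
    have h1 := edgeAt_dart hI (mem_edges.1 he)
    simp only at hef
    rw [hef, edgeAt_dart hI (mem_edges.1 hf)] at h1
    exact (Option.some.inj h1).symm

theorem totalCost_of_feasible (hI : I.ListsBoundedBy 2) (hX : Assignment I.nU X)
    (hM : I.IsFeasible (I.matchingOf X)) : I.totalCost X = (I.bp (I.matchingOf X)).card := by
  rw [totalCost, bp, Finset.card_filter]
  refine Finset.sum_congr rfl fun e he => ?_
  obtain ⟨u, w⟩ := e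
  rw [mem_edges] at he
  simp only at he ⊢
  rw [dartCost_dart hI hX he]
  by_cases h1 : (u, w) ∈ I.matchingOf X
  · have h2 : ¬ ((∃ u' ≠ u, (u', w) ∈ I.matchingOf X) ∨ (u, w) ∈ I.P) := by
      rintro (⟨u', h5, h6⟩ | h2)
      · exact h5 (congrArg Prod.fst (hM.1.2 _ h1 _ h6 (Or.inr rfl))).symm
      · exact Finset.disjoint_left.1 hM.2.1 h1 h2
    have h3 : ¬ I.Blocks (I.matchingOf X) (u, w) := fun h => h.2.1 h1
    rw [if_pos h1, if_neg h2, if_neg h3]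
  · have h2 : (u, w) ∉ I.Q := fun h => h1 (hM.2.2 h)
    rw [if_neg h1, if_neg h2, cap]
    split_ifs <;> omega

/-- By contraposition: if every edge costs less than the penalty, no edge witnesses a violated
constraint. -/
theorem penalty_le_totalCost (hI : I.ListsBoundedBy 2) (hX : Assignment I.nU X)
    (hM : ¬ I.IsFeasible (I.matchingOf X)) : I.penalty ≤ I.totalCost X := by
  classical
  have hpc : I.penalty ≤ I.cap := by unfold penalty cap; omega
  have key : ∀ u w, w ∈ I.prefU u →
      I.dartCost (I.dart u w) (X (I.dart u w)) (X (I.mate (I.dart u w))) < I.penalty →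
      ((u, w) ∈ I.matchingOf X → (∀ u', (u', w) ∈ I.matchingOf X → u' = u) ∧ (u, w) ∉ I.P) ∧
      ((u, w) ∈ I.Q → (u, w) ∈ I.matchingOf X) := by
    intro u w h hlt
    rw [dartCost_dart hI hX h] at hlt
    split_ifs at hlt with h1 h2 h3 h4
    · omega
    · push Not at h2
      refine ⟨fun _ => ⟨fun u' hu' => ?_, h2.2⟩, fun _ => h1⟩
      by_contra hne; exact h2.1 u' hne hu'
    all_goals first
      | omega
      | exact ⟨fun h => absurd h h1, fun h => absurd h h3⟩
  by_contra! hlt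
  refine hM ?_
  have key' : ∀ u w, w ∈ I.prefU u →
      ((u, w) ∈ I.matchingOf X → (∀ u', (u', w) ∈ I.matchingOf X → u' = u) ∧ (u, w) ∉ I.P) ∧
      ((u, w) ∈ I.Q → (u, w) ∈ I.matchingOf X) := fun u w h =>
    key u w h (lt_of_le_of_lt (Finset.single_le_sum (f := fun e => I.dartCost (I.dart e.1 e.2)
      (X (I.dart e.1 e.2)) (X (I.mate (I.dart e.1 e.2)))) (fun _ _ => Nat.zero_le _)
      (mem_edges (e := (u, w)).2 h)) hlt)
  refine ⟨⟨Finset.filter_subset _ _, ?_⟩, ?_, ?_⟩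
  · rintro ⟨u, w⟩ he ⟨u', w'⟩ hf (h | h)
    -- A man has a single state, so he cannot have two partners; only conflicts at women need a
    -- penalty.
    · simp only at h
      subst h
      have h1 := mem_matchingOf.1 he
      have h2 := mem_matchingOf.1 hf
      rw [(List.idxOf_inj h1.1).1 (by omega : (I.prefU u).idxOf w = (I.prefU u).idxOf w')]
    · simp only at h
      subst h
      rw [((key' u w (mem_matchingOf.1 he).1).1 he).1 u' hf]
  · refine Finset.disjoint_left.2 fun e he => ?_
    exact ((key' e.1 e.2 (mem_matchingOf.1 he).1).1 he).2
  · intro e he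
    exact (key' e.1 e.2 (I.Q_edges e he)).2 he

open Classical in
/-- The states that describe a matching. -/
noncomputable def statesOf (I : RestrictedSM) (M : Finset (Fin I.nU × Fin I.nW)) (d : ℕ) : ℕ :=
  if h : ∃ e ∈ M, d / 2 = (e.1 : ℕ) then (I.prefU h.choose.1).idxOf h.choose.2 + 1 else 0

theorem statesOf_assignment (hI : I.ListsBoundedBy 2) {M : Finset (Fin I.nU × Fin I.nW)}
    (hM : I.IsMatching M) : Assignment I.nU (I.statesOf M) where
  lt d := by
    unfold statesOf
    split_ifs with h
    · have := idxOf_lt_two hI (mem_edges.1 (hM.1 h.choose_spec.1))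
      omega
    · omega
  node u _ := by
    unfold statesOf
    rw [show (2 * u + 1) / 2 = 2 * u / 2 by omega]
  dummy d hd := by
    unfold statesOf
    rw [dif_neg]
    rintro ⟨e, -, he⟩
    have := e.1.2
    omega

/-- Every matching comes from an assignment, so a minimum over assignments bounds all feasible
matchings. -/
theorem matchingOf_statesOf {M : Finset (Fin I.nU × Fin I.nW)} (hM : I.IsMatching M) :
    I.matchingOf (I.statesOf M) = M := by
  ext ⟨u, w⟩
  rw [mem_matchingOf]
  have hu : 2 * (u : ℕ) / 2 = u := by omega
  constructor
  · rintro ⟨h1, h2⟩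
    unfold statesOf at h2
    split_ifs at h2 with h
    obtain ⟨h3, h4⟩ := h.choose_spec
    generalize h.choose = e at h2 h3 h4
    obtain ⟨u', w'⟩ := e
    obtain rfl : u = u' := Fin.ext (by simpa [hu] using h4)
    have h5 : (I.prefU u).idxOf w = (I.prefU u).idxOf w' := by simpa using h2.symm
    obtain rfl := (List.idxOf_inj h1).1 h5
    exact h3
  · intro h1
    have h : ∃ e ∈ M, 2 * (u : ℕ) / 2 = (e.1 : ℕ) := ⟨(u, w), h1, hu⟩
    refine ⟨mem_edges.1 (hM.1 h1), ?_⟩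
    unfold statesOf
    rw [dif_pos h]
    obtain ⟨h3, h4⟩ := h.choose_spec
    have : h.choose = (u, w) := hM.2 _ h3 _ h1 (Or.inl (Fin.ext (by simpa [hu] using h4.symm)))
    rw [this]

/-- An assignment of minimum capped cost describes an optimal matching, if there is a feasible
one. -/
theorem isOptimal_matchingOf (hI : I.ListsBoundedBy 2) (hX : Assignment I.nU X)
    (hmin : ∀ Y, Assignment I.nU Y → min I.cap (total I.nU 0 I.mate I.linkCost X) ≤
      min I.cap (total I.nU 0 I.mate I.linkCost Y))
    (hf : ∃ M, I.IsFeasible M) : I.IsOptimal (I.matchingOf X) := by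
  have key : ∀ M, I.IsFeasible M → I.totalCost X ≤ (I.bp M).card := by
    intro M hM
    have h1 := matchingOf_statesOf hM.1
    have h2 := statesOf_assignment hI hM.1
    have h3 := totalCost_of_feasible hI h2 (by rwa [h1])
    have h4 := hmin _ h2
    rw [min_total hI, min_total hI, h3, h1] at h4
    have h5 : (I.bp M).card ≤ 2 * I.nU :=
      (Finset.card_le_card (Finset.filter_subset _ _)).trans (card_edges_le hI)
    -- Twice the cost of a feasible matching is at most `4 * nU`, below the cap, so the capped
    -- comparison is a true one.
    unfold cap at h4
    omega
  obtain ⟨M, hM⟩ := hf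
  have hfeas : I.IsFeasible (I.matchingOf X) := by
    by_contra hc
    -- An infeasible minimiser would cost at least `2 * nU + 1`, more than any feasible matching.
    have h1 := penalty_le_totalCost hI hX hc
    have h2 := key M hM
    have h5 : (I.bp M).card ≤ 2 * I.nU :=
      (Finset.card_le_card (Finset.filter_subset _ _)).trans (card_edges_le hI)
    unfold penalty at h1
    omega
  exact ⟨hfeas, fun M' hM' => totalCost_of_feasible hI hX hfeas ▸ key M' hM'⟩

/-- There is a feasible matching if and only if no two forced edges share an agent. -/
theorem exists_isFeasible_iff : (∃ M, I.IsFeasible M) ↔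
    (∀ u w w', (u, w) ∈ I.Q → (u, w') ∈ I.Q → w = w') ∧
      ∀ w u u', (u, w) ∈ I.Q → (u', w) ∈ I.Q → u = u' := by
  constructor
  · rintro ⟨M, ⟨-, hM⟩, -, hQ⟩
    exact ⟨fun u w w' h h' => congrArg Prod.snd (hM _ (hQ h) _ (hQ h') (Or.inl rfl)),
      fun w u u' h h' => congrArg Prod.fst (hM _ (hQ h) _ (hQ h') (Or.inr rfl))⟩
  · rintro ⟨h1, h2⟩
    -- The forced edges alone are a feasible matching.
    refine ⟨I.Q, ⟨fun e he => mem_edges.2 (I.Q_edges e he), ?_⟩, I.disjoint_PQ.symm, le_rfl⟩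
    rintro ⟨u, w⟩ he ⟨u', w'⟩ hf (h | h)
    · simp only at h; subst h; rw [h1 u w w' he hf]
    · simp only at h; subst h; rw [h2 w u u' he hf]

end RestrictedSM

/-! ### Hoare triples -/

namespace RAM

/-- Started in a state with words at most `W` that satisfies `P`, the program `c` halts within
`c.timeBound * (n + 1)` units of time in a state with words at most `W` that satisfies `Q`. -/
def Triple (W n : ℕ) (P : State → Prop) (c : Cmd) (Q : State → Prop) : Prop :=
  ∀ B s, c.weight * W ≤ B → s.Bdd W → P s →
    ∃ s' t, Exec B c s s' t ∧ t ≤ c.timeBound * (n + 1) ∧ s'.Bdd W ∧ Q s'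

theorem Triple.seq {W n : ℕ} {P Q R : State → Prop} {c d : Cmd} (hc : Triple W n P c Q)
    (hd : Triple W n Q d R) : Triple W n P (c.seq d) R := by
  intro B s hB hs hP
  simp only [Cmd.weight, add_mul] at hB
  obtain ⟨s₁, t₁, h₁, ht₁, hs₁, hQ⟩ := hc B s (by omega) hs hP
  obtain ⟨s₂, t₂, h₂, ht₂, hs₂, hR⟩ := hd B s₁ (by omega) hs₁ hQ
  exact ⟨s₂, t₁ + t₂, .seq h₁ h₂, by simp only [Cmd.timeBound, add_mul]; omega, hs₂, hR⟩

theorem Triple.of_safe {W n : ℕ} (hW : 8 ≤ W) {P Q : State → Prop} {c : Cmd}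
    (hl : c.loopFree = true) (hc : ∀ s, s.Bdd W → P s → c.Safe W s)
    (h : ∀ s, P s → Q (c.run s)) : Triple W n P c Q := by
  intro B s hB hs hP
  obtain ⟨t, ht, hex⟩ := Cmd.exec_run (B := B) (by omega) hl hs (hc s hs hP) hB
  exact ⟨_, t, hex, ht.trans (Nat.le_mul_of_pos_right _ (by omega)), (hc s hs hP).bdd hs, h s hP⟩

theorem Triple.of_tame {W n : ℕ} (hW : 8 ≤ W) {P Q : State → Prop} {c : Cmd}
    (hc : c.tame = true) (h : ∀ s, P s → Q (c.run s)) : Triple W n P c Q :=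
  .of_safe hW (Cmd.loopFree_of_tame hc) (fun _ hs _ => Cmd.safe_of_tame hW hc hs) h

theorem Triple.forLoop {W n i b N : ℕ} (hW : 8 ≤ W) {c : Cmd} (hc : c.tame = true)
    (hi : c.keepsReg i = true) (hb : c.keepsReg b = true) (hib : b ≠ i) (hn : N ≤ 4 * n)
    (Inv : ℕ → State → Prop) (h_bound : ∀ k s, Inv k s → s.reg b = N)
    (h_reg : ∀ k s v, Inv k s → Inv k (s.setReg i v))
    (h_step : ∀ k s, k < N → s.reg i = k → Inv k s → Inv (k + 1) (c.run s)) :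
    Triple W n (Inv 0) (Cmd.forLoop i b c) (Inv N) := by
  intro B s hB hs hP
  have hN := h_bound 0 s hP
  obtain ⟨s', t, h⟩ := Cmd.exec_forLoop (m := n) hW hc hi hb hib hs hB (by omega) Inv h_reg hP
    (fun k s' hk => h_step k s' (by omega))
  rw [hN] at h
  exact ⟨s', t, h⟩

theorem Triple.conseq {W n : ℕ} {P P' Q Q' : State → Prop} {c : Cmd} (h : Triple W n P c Q)
    (hP : ∀ s, P' s → P s) (hQ : ∀ s, Q s → Q' s) : Triple W n P' c Q' := by
  intro B s hB hs hP'
  obtain ⟨s', t, h₁, h₂, h₃, h₄⟩ := h B s hB hs (hP s hP')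
  exact ⟨s', t, h₁, h₂, h₃, hQ s' h₄⟩

end RAM

/-! ### The input -/

namespace RestrictedSM

variable {I : RestrictedSM}

/-- The start position of row `i`. -/
def rowStart {k : ℕ} {α : Type} (f : Fin k → List α) (i : ℕ) : ℕ :=
  ((List.ofFn f).take i).flatten.length

theorem rowStarts_getD {k : ℕ} {α : Type} (f : Fin k → List α) {i : ℕ} (hi : i ≤ k) :
    (rowStarts f).getD i 0 = rowStart f i := by
  rw [rowStarts, List.getD_eq_getElem _ _ (by simp; omega)]
  simp [rowStart]

theorem rowStart_succ {k : ℕ} {α : Type} (f : Fin k → List α) (u : Fin k) :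
    rowStart f (u + 1) = rowStart f u + (f u).length := by
  rw [rowStart, rowStart, List.take_add_one]
  simp

theorem rowStart_map {k : ℕ} {α β : Type} (f : Fin k → List α) (g : Fin k → α → β) (i : ℕ) :
    rowStart (fun u => (f u).map (g u)) i = rowStart f i := by
  simp only [rowStart, List.length_flatten, List.map_take, List.map_ofFn]
  congr 2
  ext1
  simp

theorem flatten_getD {k : ℕ} {α : Type} (f : Fin k → List α) (g : Fin k → α → ℕ) (u : Fin k)
    {s : ℕ} (hs : s < (f u).length) :
    (List.ofFn fun u => (f u).map (g u)).flatten.getD (rowStart f u + s) 0 = g u (f u)[s] := by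
  set F := fun u => (f u).map (g u) with hF
  have h1 : List.ofFn F = (List.ofFn F).take u ++ F u :: (List.ofFn F).drop (u + 1) := by
    conv_lhs => rw [← List.take_append_drop u (List.ofFn F)]
    rw [List.drop_eq_getElem_cons (by simp)]
    simp
  rw [h1, List.flatten_append, List.flatten_cons, ← rowStart_map f g u,
    List.getD_append_right _ _ _ _ (by simp [rowStart, hF])]
  have h2 : rowStart F u + s - ((List.ofFn F).take u).flatten.length = s := by
    simp [rowStart]
  rw [h2, List.getD_append _ _ _ _ (by simpa [hF] using hs),
    List.getD_eq_getElem _ _ (by simpa [hF] using hs)]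
  simp [hF]

theorem flatten_length_le {k : ℕ} {α : Type} (f : Fin k → List α) (c : ℕ)
    (hf : ∀ u, (f u).length ≤ c) (i : ℕ) : rowStart f i ≤ c * k := by
  have h1 : rowStart f i ≤ (List.ofFn f).flatten.length := by
    conv_rhs => rw [← List.take_append_drop i (List.ofFn f)]
    rw [List.flatten_append, List.length_append, rowStart]
    exact Nat.le_add_right _ _
  refine h1.trans ?_
  rw [List.length_flatten, List.map_ofFn, List.sum_ofFn]
  calc ∑ u, (List.length ∘ f) u ≤ ∑ _u : Fin k, c := Finset.sum_le_sum fun u _ => hf u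
    _ = c * k := by simp [mul_comm]

theorem inputBank_one :
    I.inputBank 1 = (List.ofFn fun u => (I.prefU u).map fun w : Fin I.nW => (w : ℕ)).flatten := by
  simp only [inputBank]
  congr 2
  funext u
  induction I.prefU u with
  | nil => rfl
  | cons a l ih => simp_all

theorem inputBank_four :
    I.inputBank 4 = (List.ofFn fun w => (I.prefW w).map fun u : Fin I.nU => (u : ℕ)).flatten := by
  simp only [inputBank]
  congr 2
  funext u
  induction I.prefW u with
  | nil => rfl
  | cons a l ih => simp_all

theorem label_le (u : Fin I.nU) (w : Fin I.nW) : I.label u w ≤ 2 := by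
  unfold label; split_ifs <;> omega

/-- Input words are at most `2 * n` or `2`. The factor 8 also leaves room for `cap` and for the
constants allowed by `tame`. -/
theorem initialState_bdd (hI : I.ListsBoundedBy 2) :
    I.initialState.Bdd (8 * (I.n + 1)) := by
  have hflat : ∀ {k : ℕ} {α : Type} (f : Fin k → List α) (g : Fin k → α → ℕ) (c i : ℕ),
      (∀ u x, g u x ≤ c) → (List.ofFn fun u => (f u).map (g u)).flatten.getD i 0 ≤ c := by
    intro k α f g c i h
    rw [List.getD_eq_getElem?_getD]
    cases hx : (List.ofFn fun u => (f u).map (g u)).flatten[i]? with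
    | none => simp
    | some x =>
      have := List.mem_of_getElem? hx
      simp only [List.mem_flatten, List.mem_ofFn] at this
      obtain ⟨l, ⟨u, rfl⟩, hx'⟩ := this
      obtain ⟨y, -, rfl⟩ := List.mem_map.1 hx'
      exact h u y
  have hrow : ∀ {k : ℕ} {α : Type} (f : Fin k → List α) (i : ℕ), (∀ u, (f u).length ≤ 2) →
      (rowStarts f).getD i 0 ≤ 2 * k := by
    intro k α f i hf
    by_cases hi : i ≤ k
    · rw [rowStarts_getD f hi]; exact flatten_length_le f 2 hf i
    · rw [List.getD_eq_default _ _ (by simp [rowStarts]; omega)]; omega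
  refine ⟨fun r => ?_, fun b i => ?_⟩
  · simp only [initialState, n]; split_ifs <;> omega
  · simp only [initialState]
    match b with
    | 0 => have := hrow I.prefU i hI.1; simp only [n, inputBank]; omega
    | 1 =>
      have := hflat I.prefU (fun _ w => (w : ℕ)) I.nW i (fun _ w => by omega)
      rw [inputBank_one]
      simp only [n]; omega
    | 2 =>
      have := hflat I.prefU (fun u w => I.label u w) 2 i (fun u w => label_le u w)
      simp only [n, inputBank]; omega
    | 3 => have := hrow I.prefW i hI.2; simp only [n, inputBank]; omega
    | 4 =>
      have := hflat I.prefW (fun _ w => (w : ℕ)) I.nU i (fun _ w => by omega)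
      rw [inputBank_four]
      simp only [n]; omega
    | 5 =>
      have := hflat I.prefW (fun w u => I.label u w) 2 i (fun w u => label_le u w)
      simp only [n, inputBank]; omega
    | b + 6 => simp [inputBank]

end RestrictedSM

/-! ### The program -/

namespace RAM

open RAM.Expr RAM.Cmd

/-- The position of the entry for own state `j` and mate state `i` in the table of dart `e`. -/
def cell (e : Expr) (j : ℕ) (i : Expr) : Expr :=
  -- Nine copies of `e`, for want of multiplication.
  add (add (add (add (add (add e e) e) (add (add e e) e)) (add (add e e) e)) (const (3 * j))) i

@[simp] theorem eval_cell (s : State) (e : Expr) (j : ℕ) (i : Expr) :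
    (cell e j i).eval s = 9 * e.eval s + 3 * j + i.eval s := by
  simp only [cell, eval]; omega

/-- The pairs of states. -/
def statePairs : List (ℕ × ℕ) :=
  [(0, 0), (0, 1), (0, 2), (1, 0), (1, 1), (1, 2), (2, 0), (2, 1), (2, 2)]

theorem mem_statePairs {p : ℕ × ℕ} : p ∈ statePairs ↔ p.1 < 3 ∧ p.2 < 3 := by
  obtain ⟨j, i⟩ := p
  constructor
  · intro h
    simp only [statePairs, List.mem_cons, Prod.mk.injEq, List.not_mem_nil, or_false] at h
    simp only
    omega
  · rintro ⟨hj, hi⟩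
    simp only at hj hi
    interval_cases j <;> interval_cases i <;> simp [statePairs]

/-- Write the table of the dart in register `r` to bank `b`. -/
def storeTable (b r : ℕ) (v : ℕ → ℕ → Expr) : Cmd :=
  storeAll b (fun p => cell (reg r) p.1 (const p.2)) (fun p => v p.1 p.2) statePairs

/-- The address `9 * d + 3 * j + i` determines `d`, `j` and `i`, so tables of different darts are
disjoint. The values may read the bank being written, but must not depend on the table being
overwritten. -/
theorem run_storeTable {b r : ℕ} {v : ℕ → ℕ → Expr} {s : State} (V : ℕ → ℕ → ℕ)
    (h : ∀ s' : State, s'.reg = s.reg → (∀ b' ≠ b, s'.mem b' = s.mem b') →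
      (∀ d j i, d ≠ s.reg r → j < 3 → i < 3 →
        s'.mem b (9 * d + 3 * j + i) = s.mem b (9 * d + 3 * j + i)) →
      ∀ j < 3, ∀ i < 3, (v j i).eval s' = V j i) :
    (∀ j < 3, ∀ i < 3, ((storeTable b r v).run s).mem b (9 * s.reg r + 3 * j + i) = V j i) ∧
      ∀ d j i, d ≠ s.reg r → j < 3 → i < 3 →
        ((storeTable b r v).run s).mem b (9 * d + 3 * j + i) = s.mem b (9 * d + 3 * j + i) := by
  obtain ⟨h1, h2⟩ := run_storeAll (b := b) (a := fun p => cell (reg r) p.1 (const p.2))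
    (v := fun p => v p.1 p.2) (l := statePairs) (s := s)
    (fun p => 9 * s.reg r + 3 * p.1 + p.2) (fun p => V p.1 p.2) (by
      rintro ⟨j, i⟩ hp ⟨j', i'⟩ hq h
      rw [mem_statePairs] at hp hq
      simp only at hp hq h
      rw [Prod.mk.injEq]
      omega) (by
      rintro s' hr hm hx ⟨j, i⟩ hp
      rw [mem_statePairs] at hp
      refine ⟨by simp [eval, hr], h s' hr hm (fun d j i hd hj hi => hx _ ?_) j hp.1 i hp.2⟩
      rintro ⟨j', i'⟩ hp
      rw [mem_statePairs] at hp
      simp only at hp ⊢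
      omega)
  refine ⟨fun j hj i hi => h1 (j, i) (mem_statePairs.2 ⟨hj, hi⟩), fun d j i hd hj hi => h2 _ ?_⟩
  rintro ⟨j', i'⟩ hp
  rw [mem_statePairs] at hp
  simp only at hp ⊢
  omega

theorem storeTable_keepsReg (b r : ℕ) (v : ℕ → ℕ → Expr) (r' : ℕ) :
    (storeTable b r v).keepsReg r' = true := storeAll_keepsReg ..

theorem storeTable_keepsBank {b b' : ℕ} (r : ℕ) (v : ℕ → ℕ → Expr) (h : b' ≠ b) :
    (storeTable b r v).keepsBank b' = true := storeAll_keepsBank h ..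

/-- The value of an expression, capped by register `3`. -/
def capped (e : Expr) : Expr := (reg 3).min e

/-- Compute the constants. -/
def prelude : Cmd :=
  -- Layout: register 2 is the loop counter, 3 the cap, 4 the number of darts, 5 the feasibility
  -- flag. Bank 7 maps truth values to penalties, 8 holds mates, 9 dart costs, 10 link tables, 11
  -- states.
  .seq (.assign 4 (add (add (reg 0) (reg 0)) (add (reg 0) (reg 0))))
    (.seq (.assign 3 (add (reg 4) (const 2)))
      (.seq (.store 7 (const 1) (add (add (reg 0) (reg 0)) (const 1)))
        (.assign 5 (const 1))))

/-- Clear register `5` if the list in banks `b`, `b + 1`, `b + 2` that is counted by register `2`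
has two forced edges. -/
def checkForced (b : ℕ) : Cmd :=
  .seq (.assign 10 (load b (reg 2)))
    (.branch (lt (add (reg 10) (const 1)) (load b (add (reg 2) (const 1))))
      (.branch (eq (load (b + 2) (reg 10)) (const 2))
        (.branch (eq (load (b + 2) (add (reg 10) (const 1))) (const 2))
          (.assign 5 (const 0)) .skip) .skip) .skip)

/-- Link the dart in register `16` with its dummy dart. -/
def linkDummy : Cmd :=
  -- Darts are below the cap, so `capped` does not change the value; it only makes the expression
  -- tame.
  .seq (.store 8 (reg 16) (capped (add (add (reg 0) (reg 0)) (reg 16))))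
    (.store 8 (add (add (reg 0) (reg 0)) (reg 16)) (reg 16))

/-- Link the dart in register `16` with the dart of the rival. -/
def linkRival : Cmd :=
  -- If `u` is in position `r` of a list of length two, the rival is in position `1 - r`.
  .seq (.assign 15 (load 4 (add (reg 18) (sub (const 1) (reg 13)))))
    (.seq (.assign 14 (sub (const 1) (eq (load 1 (load 0 (reg 15))) (reg 11))))
      (.seq (.store 8 (reg 16) (capped (add (add (reg 15) (reg 15)) (reg 14))))
        (.store 8 (add (add (reg 0) (reg 0)) (reg 16))
          (capped (add (add (reg 0) (reg 0)) (reg 16))))))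

/-- The cost of an edge in position `s` in states `j` and `i`. -/
def costExpr (s j i : ℕ) : Expr :=
  if j = s + 1 then
    -- A positive sum of truth values is a disjunction; below, a sum less than 2 is a negated
    -- conjunction.
    load 7 (lt (const 0) (add (eq (const i) (add (reg 14) (const 1))) (eq (reg 12) (const 1))))
  else capped (add (load 7 (eq (reg 12) (const 2)))
    (if j = 0 ∨ s + 1 < j then
      lt (add (eq (const i) (add (reg 14) (const 1))) (eq (reg 13) (const 1))) (const 2)
    else const 0))

/-- Load the dart in position `s` of the man in register `2`. -/
def loadSlot (s : ℕ) : Cmd :=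
  .seq (.assign 10 (load 0 (reg 2)))
    (.seq (.assign 16 (capped (add (add (reg 2) (reg 2)) (const s)))) (.assign 14 (const 0)))

/-- Load the edge in position `s` of the man in register `2`. -/
def loadEdge (s : ℕ) : Cmd :=
  .seq (.assign 11 (load 1 (add (reg 10) (const s))))
    (.seq (.assign 12 (load 2 (add (reg 10) (const s))))
      (.seq (.assign 18 (load 3 (reg 11)))
        (.assign 13 (sub (const 1) (eq (load 4 (reg 18)) (reg 2))))))

/-- Compute the link and the costs of the dart in position `s` of the man in register `2`. -/
def initSlot (s : ℕ) : Cmd :=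
  .seq (loadSlot s)
    (.branch (lt (add (reg 10) (const s)) (load 0 (add (reg 2) (const 1))))
      (.seq (loadEdge s)
        (.seq (.branch (lt (add (reg 18) (const 1)) (load 3 (add (reg 11) (const 1))))
          linkRival linkDummy)
          (storeTable 9 16 (costExpr s))))
      linkDummy)

/-- Compute the cost table of the dart in register `2`. -/
def initTable : Cmd :=
  .seq (.assign 10 (reg 2)) (.seq (.assign 11 (load 8 (reg 2)))
    (storeTable 10 10 fun j i => capped (add (load 9 (cell (reg 10) j (const i)))
      (load 9 (cell (reg 11) i (const j))))))

/-- The cost of an optimal state for the man with darts in registers `10` and `11`. -/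
def bestExpr (i l : ℕ) : Expr :=
  capped ((add (load 10 (cell (reg 10) 0 (const i))) (load 10 (cell (reg 11) 0 (const l)))).min
    ((add (load 10 (cell (reg 10) 1 (const i))) (load 10 (cell (reg 11) 1 (const l)))).min
      (add (load 10 (cell (reg 10) 2 (const i))) (load 10 (cell (reg 11) 2 (const l))))))

/-- Load the darts of the man in register `r` and their mates. -/
def loadLinks (r : ℕ) : Cmd :=
  .seq (.assign 10 (capped (add (reg r) (reg r))))
    (.seq (.assign 11 (capped (add (add (reg r) (reg r)) (const 1))))
      (.seq (.assign 12 (load 8 (reg 10))) (.assign 13 (load 8 (reg 11)))))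

/-- Eliminate the man in register `2`. -/
def eliminate : Cmd :=
  .seq (loadLinks 2) (.branch (eq (reg 12) (reg 11)) .skip
    (.seq (storeTable 10 12 bestExpr)
      (.seq (storeTable 10 13 fun l i => bestExpr i l)
        (.seq (.store 8 (reg 12) (reg 13)) (.store 8 (reg 13) (reg 12))))))

/-- Write the index of the smallest of three numbers to register `17`. -/
def argmin (x y z : Expr) : Cmd :=
  .branch (lt y x)
    (.branch (lt z y) (.assign 17 (const 2)) (.assign 17 (const 1)))
    (.branch (lt z x) (.assign 17 (const 2)) (.assign 17 (const 0)))

/-- The cost of state `j` of the man with darts in registers `10` and `11`, for the states of the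
mates in registers `14` and `15`. -/
def nodeExpr (j : ℕ) : Expr :=
  add (load 10 (cell (reg 10) j (reg 14))) (load 10 (cell (reg 11) j (reg 15)))

/-- Compute the state of a man whose later neighbours have their final states. -/
def backtrack : Cmd :=
  -- The counter runs upwards while the men are visited in descending order.
  .seq (.assign 16 (sub (sub (reg 0) (const 1)) (reg 2))) (.seq (loadLinks 16)
    (.seq (.assign 14 (load 11 (reg 12))) (.seq (.assign 15 (load 11 (reg 13)))
      (.seq (.branch (eq (reg 12) (reg 11))
        (argmin (load 10 (cell (reg 10) 0 (const 0))) (load 10 (cell (reg 10) 1 (const 1)))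
          (load 10 (cell (reg 10) 2 (const 2))))
        (argmin (nodeExpr 0) (nodeExpr 1) (nodeExpr 2)))
        (.seq (.store 11 (reg 10) (reg 17)) (.store 11 (reg 11) (reg 17)))))))

/-- Write the partner of the man in register `2`. -/
def output : Cmd :=
  .seq (.assign 10 (load 11 (add (reg 2) (reg 2)))) (.seq (.assign 11 (load 0 (reg 2)))
    (.branch (lt (const 0) (reg 10))
      -- A state pointing past the end of the list means unmatched, and the cell keeps its value 0.
      (.branch (lt (add (reg 11) (sub (reg 10) (const 1))) (load 0 (add (reg 2) (const 1))))
        (.store 6 (reg 2)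
          ((reg 1).min (add (load 1 (add (reg 11) (sub (reg 10) (const 1)))) (const 1))))
        .skip) .skip))

/-- The program for instances with preference lists of length at most `2`. -/
def program : Cmd :=
  .seq prelude (.seq (forLoop 2 0 (checkForced 0)) (.seq (forLoop 2 1 (checkForced 3))
    (.seq (forLoop 2 0 (.seq (initSlot 0) (initSlot 1))) (.seq (forLoop 2 4 initTable)
      (.seq (forLoop 2 0 eliminate) (.seq (forLoop 2 0 backtrack)
        (.seq (forLoop 2 0 output) (.assign 0 (reg 5)))))))))

end RAM

namespace RestrictedSM

/-! ### Correctness of the program segments -/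

open RAM RAM.Expr RAM.Cmd

variable {I : RestrictedSM}

/-- The input and the constants are in place. -/
structure Env (I : RestrictedSM) (s : State) : Prop where
  reg0 : s.reg 0 = I.nU
  reg1 : s.reg 1 = I.nW
  reg3 : s.reg 3 = I.cap
  reg4 : s.reg 4 = 4 * I.nU
  input : ∀ b < 6, ∀ i, s.mem b i = (I.inputBank b).getD i 0
  pen0 : s.mem 7 0 = 0
  pen1 : s.mem 7 1 = I.penalty

/-- The program does not change the input and the constants. -/
def keepsEnv (c : Cmd) : Bool :=
  c.keepsReg 0 && c.keepsReg 1 && c.keepsReg 3 && c.keepsReg 4 &&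
    (List.range 6).all (fun b => c.keepsBank b) && c.keepsBank 7

theorem Env.run {s : State} (h : Env I s) {c : Cmd} (hc : keepsEnv c = true) :
    Env I (c.run s) := by
  simp only [keepsEnv, Bool.and_eq_true, List.all_eq_true, List.mem_range] at hc
  obtain ⟨⟨⟨⟨⟨h0, h1⟩, h3⟩, h4⟩, hb⟩, h7⟩ := hc
  refine ⟨?_, ?_, ?_, ?_, fun b hb' i => ?_, ?_, ?_⟩
  · rw [run_reg_of_keepsReg h0, h.reg0]
  · rw [run_reg_of_keepsReg h1, h.reg1]
  · rw [run_reg_of_keepsReg h3, h.reg3]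
  · rw [run_reg_of_keepsReg h4, h.reg4]
  · rw [run_mem_of_keepsBank (hb b hb'), h.input b hb']
  · rw [run_mem_of_keepsBank h7, h.pen0]
  · rw [run_mem_of_keepsBank h7, h.pen1]

theorem Env.setReg {s : State} (h : Env I s) (v : ℕ) : Env I (s.setReg 2 v) :=
  ⟨by simp [h.reg0], by simp [h.reg1], by simp [h.reg3], by simp [h.reg4],
    by simpa using h.input, h.pen0, h.pen1⟩

theorem Env.man_start {s : State} (h : Env I s) (u : Fin I.nU) :
    s.mem 0 u = rowStart I.prefU u := by
  rw [h.input 0 (by omega)]; exact rowStarts_getD _ (by omega)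

theorem Env.man_end {s : State} (h : Env I s) (u : Fin I.nU) :
    s.mem 0 (u + 1) = rowStart I.prefU u + (I.prefU u).length := by
  rw [h.input 0 (by omega), ← rowStart_succ]; exact rowStarts_getD _ (by omega)

theorem Env.man_entry {s : State} (h : Env I s) (u : Fin I.nU)
    {k : ℕ} (hk : k < (I.prefU u).length) :
    s.mem 1 (rowStart I.prefU u + k) = (I.prefU u)[k] := by
  rw [h.input 1 (by omega), inputBank_one]; exact flatten_getD I.prefU (fun _ w => (w : ℕ)) u hk

theorem Env.man_label {s : State} (h : Env I s) (u : Fin I.nU)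
    {k : ℕ} (hk : k < (I.prefU u).length) :
    s.mem 2 (rowStart I.prefU u + k) = I.label u (I.prefU u)[k] := by
  rw [h.input 2 (by omega)]; exact flatten_getD I.prefU (fun u w => I.label u w) u hk

theorem Env.woman_start {s : State} (h : Env I s) (w : Fin I.nW) :
    s.mem 3 w = rowStart I.prefW w := by
  rw [h.input 3 (by omega)]; exact rowStarts_getD _ (by omega)

theorem Env.woman_end {s : State} (h : Env I s) (w : Fin I.nW) :
    s.mem 3 (w + 1) = rowStart I.prefW w + (I.prefW w).length := by
  rw [h.input 3 (by omega), ← rowStart_succ]; exact rowStarts_getD _ (by omega)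

theorem Env.woman_entry {s : State} (h : Env I s) (w : Fin I.nW)
    {k : ℕ} (hk : k < (I.prefW w).length) :
    s.mem 4 (rowStart I.prefW w + k) = (I.prefW w)[k] := by
  rw [h.input 4 (by omega), inputBank_four]; exact flatten_getD I.prefW (fun _ u => (u : ℕ)) w hk

theorem Env.woman_label {s : State} (h : Env I s) (w : Fin I.nW)
    {k : ℕ} (hk : k < (I.prefW w).length) :
    s.mem 5 (rowStart I.prefW w + k) = I.label (I.prefW w)[k] w := by
  rw [h.input 5 (by omega)]; exact flatten_getD I.prefW (fun w u => I.label u w) w hk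

/-! ### The check for forced edges that share an agent -/

-- Only a list with two entries can contain a conflict, so comparing the labels in its two positions
-- suffices.
open Classical in
theorem run_checkForced {α : Type} {l : List α} (hl : l.Nodup) (hl2 : l.length ≤ 2) (p : α → Prop)
    {b k x : ℕ} {s : State} (hk : s.reg 2 = k) (hx : s.mem b k = x)
    (hx' : s.mem b (k + 1) = x + l.length)
    (hp : ∀ j (hj : j < l.length), s.mem (b + 2) (x + j) = 2 ↔ p l[j]) :
    ((checkForced b).run s).reg 5 =
      if ∀ y ∈ l, ∀ z ∈ l, p y → p z → y = z then s.reg 5 else 0 := by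
  have h1 : ((checkForced b).run s).reg 5 =
      if 1 < l.length ∧ s.mem (b + 2) x = 2 ∧ s.mem (b + 2) (x + 1) = 2 then 0 else s.reg 5 := by
    have h1 : x + 1 < x + l.length ↔ 1 < l.length := by omega
    simp only [checkForced, Cmd.run, eval, State.setReg_reg, State.setReg_mem, hk, hx]
    by_cases h2 : 1 < l.length <;> by_cases h3 : s.mem (b + 2) x = 2 <;>
      by_cases h4 : s.mem (b + 2) (x + 1) = 2 <;> simp [h1, h2, h3, h4, hx']
  rw [h1]
  match l, hl, hl2 with
  | [], _, _ => simp
  | [a], _, _ => simp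
  | [a, c], hl, _ =>
    have hac : a ≠ c := by simpa using hl
    have h2 := hp 0 (by simp)
    have h3 := hp 1 (by simp)
    simp only [List.getElem_cons_zero, List.getElem_cons_succ, add_zero] at h2 h3
    simp only [h2, h3]
    have h4 : (∀ y ∈ [a, c], ∀ z ∈ [a, c], p y → p z → y = z) ↔ ¬ (p a ∧ p c) := by
      simp only [List.mem_cons, List.not_mem_nil, or_false]
      constructor
      · rintro h ⟨ha, hc⟩; exact hac (h a (by simp) c (by simp) ha hc)
      · rintro h y (rfl | rfl) z (rfl | rfl) hy hz <;> tauto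
    by_cases h5 : p a ∧ p c
    · rw [if_pos ⟨by simp, h5⟩, if_neg (by rw [h4]; exact not_not.2 h5)]
    · rw [if_neg (fun h => h5 h.2), if_pos (h4.2 h5)]

/-- The first `k` men and the first `l` women have at most one forced edge each. -/
def ForcedOnce (I : RestrictedSM) (k l : ℕ) : Prop :=
  (∀ u : Fin I.nU, (u : ℕ) < k → ∀ w w', (u, w) ∈ I.Q → (u, w') ∈ I.Q → w = w') ∧
    ∀ w : Fin I.nW, (w : ℕ) < l → ∀ u u', (u, w) ∈ I.Q → (u', w) ∈ I.Q → u = u'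

theorem ForcedOnce.mono {k k' l l' : ℕ} (h : ForcedOnce I k l) (hk : k' ≤ k) (hl : l' ≤ l) :
    ForcedOnce I k' l' :=
  ⟨fun u hu => h.1 u (by omega), fun w hw => h.2 w (by omega)⟩

open Classical in
theorem run_checkForced_man (hI : I.ListsBoundedBy 2) {s : State} (h : Env I s) (u : Fin I.nU)
    (hu : s.reg 2 = u) (hs : s.reg 5 = if ForcedOnce I u 0 then 1 else 0) :
    ((checkForced 0).run s).reg 5 = if ForcedOnce I (u + 1) 0 then 1 else 0 := by
  rw [run_checkForced (I.nodupU u) (hI.1 u) (fun w => (u, w) ∈ I.Q) hu (h.man_start u)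
    (h.man_end u) (fun j hj => by rw [zero_add, h.man_label u hj, label_eq_two]), hs]
  have h1 : ForcedOnce I (u + 1) 0 ↔
      (∀ w ∈ I.prefU u, ∀ w' ∈ I.prefU u, (u, w) ∈ I.Q → (u, w') ∈ I.Q → w = w') ∧
        ForcedOnce I u 0 := by
    refine ⟨fun h' => ⟨fun w _ w' _ => h'.1 u (by omega) w w', h'.mono (by omega) le_rfl⟩,
      fun h' => ⟨fun u' hu' w w' hw hw' => ?_, fun _ hw => by omega⟩⟩
    by_cases huu : u' = u
    · subst huu; exact h'.1 w (I.Q_edges _ hw) w' (I.Q_edges _ hw') hw hw'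
    · exact h'.2.1 u' (by have := Fin.val_ne_of_ne huu; omega) w w' hw hw'
  simp only [h1, ite_and]
  split_ifs <;> rfl

open Classical in
theorem run_checkForced_woman (hI : I.ListsBoundedBy 2) {s : State} (h : Env I s) (w : Fin I.nW)
    (hw : s.reg 2 = w) (hs : s.reg 5 = if ForcedOnce I I.nU w then 1 else 0) :
    ((checkForced 3).run s).reg 5 = if ForcedOnce I I.nU (w + 1) then 1 else 0 := by
  rw [run_checkForced (I.nodupW w) (hI.2 w) (fun u => (u, w) ∈ I.Q) hw (h.woman_start w)
    (h.woman_end w) (fun j hj => by rw [h.woman_label w hj, label_eq_two]), hs]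
  have h1 : ForcedOnce I I.nU (w + 1) ↔
      (∀ u ∈ I.prefW w, ∀ u' ∈ I.prefW w, (u, w) ∈ I.Q → (u', w) ∈ I.Q → u = u') ∧
        ForcedOnce I I.nU w := by
    refine ⟨fun h' => ⟨fun u _ u' _ => h'.2 w (by omega) u u', h'.mono le_rfl (by omega)⟩,
      fun h' => ⟨h'.2.1, fun w' hw' u u' hu hu' => ?_⟩⟩
    by_cases hww : w' = w
    · subst hww
      exact h'.1 u ((I.mutual_acceptable _ _).1 (I.Q_edges _ hu)) u'
        ((I.mutual_acceptable _ _).1 (I.Q_edges _ hu')) hu hu'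
    · exact h'.2.2 w' (by have := Fin.val_ne_of_ne hww; omega) u u' hu hu'
  simp only [h1, ite_and]
  split_ifs <;> rfl

theorem forcedOnce_iff : ForcedOnce I I.nU I.nW ↔ ∃ M, I.IsFeasible M := by
  rw [exists_isFeasible_iff]
  exact ⟨fun h => ⟨fun u => h.1 u u.2, fun w => h.2 w w.2⟩,
    fun h => ⟨fun u _ => h.1 u, fun w _ => h.2 w⟩⟩

/-! ### The links and the costs of the darts -/

/-- With at most two entries, one comparison with the first entry gives the position; the program
computes positions in this way. -/
theorem idxOf_eq (hI : I.ListsBoundedBy 2) {u : Fin I.nU} {w : Fin I.nW} (h : w ∈ I.prefU u)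
    (h0 : 0 < (I.prefU u).length) :
    (I.prefU u).idxOf w = 1 - if (I.prefU u)[0] = w then 1 else 0 := by
  have h1 := idxOf_lt_two hI h
  split_ifs with h2
  · rw [← h2, (I.nodupU u).idxOf_getElem]
  · have : (I.prefU u).idxOf w ≠ 0 := fun h3 => h2 (by
      conv_rhs => rw [← List.getElem_idxOf (List.idxOf_lt_length_iff.2 h)]
      simp only [h3])
    omega

theorem idxOf_eq' (hI : I.ListsBoundedBy 2) {u : Fin I.nU} {w : Fin I.nW} (h : u ∈ I.prefW w)
    (h0 : 0 < (I.prefW w).length) :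
    (I.prefW w).idxOf u = 1 - if (I.prefW w)[0] = u then 1 else 0 := by
  have h1 := idxOf_lt_two' hI h
  split_ifs with h2
  · rw [← h2, (I.nodupW w).idxOf_getElem]
  · have : (I.prefW w).idxOf u ≠ 0 := fun h3 => h2 (by
      conv_rhs => rw [← List.getElem_idxOf (List.idxOf_lt_length_iff.2 h)]
      simp only [h3])
    omega

theorem rival_of_length (hI : I.ListsBoundedBy 2) {u : Fin I.nU} {w : Fin I.nW}
    (h : w ∈ I.prefU u) (hl : 1 < (I.prefW w).length) :
    I.rival u w = some ((I.prefW w)[1 - (I.prefW w).idxOf u]'(by omega)) := by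
  have h1 := idxOf_lt_two' hI ((I.mutual_acceptable u w).1 h)
  rw [rival_eq_some hI h, I.mutual_acceptable]
  refine ⟨List.getElem_mem _, fun h2 => ?_⟩
  have h3 := (I.nodupW w).idxOf_getElem (1 - (I.prefW w).idxOf u) (by omega)
  rw [h2] at h3
  omega

theorem rival_eq_none (hI : I.ListsBoundedBy 2) {u : Fin I.nU} {w : Fin I.nW}
    (h : w ∈ I.prefU u) (hl : ¬ 1 < (I.prefW w).length) : I.rival u w = none := by
  cases hr : I.rival u w with
  | none => rfl
  | some u' =>
    obtain ⟨h1, h2⟩ := (rival_eq_some hI h).1 hr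
    rw [I.mutual_acceptable] at h h1
    have h3 := List.idxOf_lt_length_iff.2 h
    have h4 := List.idxOf_lt_length_iff.2 h1
    exact absurd ((List.idxOf_inj h1).1 (by omega)) h2

theorem eval_costExpr {s : State} (h : Env I s) (a j i : ℕ) :
    (costExpr a j i).eval s = I.stateCost (s.reg 12) (s.reg 13) (s.reg 14) a j i := by
  unfold costExpr stateCost
  by_cases h1 : j = a + 1
  · rw [if_pos h1, if_pos h1]
    by_cases h2 : i = s.reg 14 + 1 <;> by_cases h3 : s.reg 12 = 1 <;>
      simp [eval, h2, h3, h.pen0, h.pen1]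
  · rw [if_neg h1, if_neg h1]
    by_cases h2 : j = 0 ∨ a + 1 < j <;> by_cases h3 : s.reg 12 = 2 <;>
      by_cases h4 : i = s.reg 14 + 1 <;> by_cases h5 : s.reg 13 = 1 <;>
      simp [eval, capped, h.reg3, h2, h3, h4, h5, h.pen0, h.pen1]

/-- Cell `d` of bank `8` holds the mate of dart `d`, and so does the cell of its dummy dart; nothing
else in this bank has changed. -/
structure LinkSet (I : RestrictedSM) (d : ℕ) (s s' : State) : Prop where
  mate : s'.mem 8 d = I.mate d
  dummy : s'.mem 8 (2 * I.nU + d) = I.mate (2 * I.nU + d)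
  other : ∀ x, x ≠ d → x ≠ 2 * I.nU + d → s'.mem 8 x = s.mem 8 x

theorem run_linkDummy {s : State} (h : Env I s) {d : ℕ} (hd : d < 2 * I.nU) (h16 : s.reg 16 = d)
    (hm : I.manMate d = 2 * I.nU + d) : LinkSet I d s (linkDummy.run s) := by
  have h1 : I.mate d = 2 * I.nU + d := by rw [mate, if_pos hd, hm]
  have h2 : I.mate (2 * I.nU + d) = d := by
    rw [mate, if_neg (by omega), Nat.add_sub_cancel_left, if_pos hm]
  have h3 : min I.cap (2 * I.nU + d) = 2 * I.nU + d := by unfold cap; omega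
  have h4 : d ≠ 2 * I.nU + d := by omega
  refine ⟨?_, ?_, fun x hx hx' => ?_⟩
  · simp [linkDummy, Cmd.run, eval, capped, h16, h.reg0, h.reg3, h1, ← two_mul, h3]
  · simp [linkDummy, Cmd.run, eval, h16, h.reg0, h2, ← two_mul]
  · simp [linkDummy, Cmd.run, eval, h16, h.reg0, ← two_mul, hx, hx']

theorem run_linkRival (hI : I.ListsBoundedBy 2) {s : State} (h : Env I s) {u : Fin I.nU}
    {w : Fin I.nW} {d : ℕ} (he : I.edgeAt d = some (u, w)) (hl : 1 < (I.prefW w).length)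
    (h16 : s.reg 16 = d) (h11 : s.reg 11 = w) (h18 : s.reg 18 = rowStart I.prefW w)
    (h13 : s.reg 13 = (I.prefW w).idxOf u) :
    LinkSet I d s (linkRival.run s) ∧ (linkRival.run s).reg 14 = I.rivalSlot u w := by
  obtain ⟨hd, hw, hdu, -⟩ := edgeAt_of_lt he
  have hr := rival_of_length hI hw hl
  set u' := (I.prefW w)[1 - (I.prefW w).idxOf u]'(by omega) with hu'
  obtain ⟨hw', hne⟩ := (rival_eq_some hI hw).1 hr
  have hm := manMate_of_rival he hr
  have hs : I.rivalSlot u w = (I.prefU u').idxOf w := by simp only [rivalSlot, hr]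
  have h0 : 0 < (I.prefU u').length := List.length_pos_of_mem hw'
  have hd' := (edgeAt_of_lt (edgeAt_dart hI hw')).1
  have h1 : I.mate d = 2 * u' + (I.prefU u').idxOf w := by rw [mate, if_pos hd, hm]; rfl
  have h2 : I.mate (2 * I.nU + d) = 2 * I.nU + d := by
    rw [mate, if_neg (by omega), Nat.add_sub_cancel_left, if_neg (by omega)]
  have h3 : min I.cap (2 * I.nU + d) = 2 * I.nU + d := by unfold cap; omega
  have h4 : d ≠ 2 * I.nU + d := by omega
  have h5 : min I.cap (2 * u' + (I.prefU u').idxOf w) = 2 * u' + (I.prefU u').idxOf w := by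
    unfold dart at hd'; unfold cap; omega
  have h6 : s.mem 4 (rowStart I.prefW w + (1 - (I.prefW w).idxOf u)) = u' :=
    h.woman_entry w (by omega)
  have h7 : s.mem 1 (rowStart I.prefU u') = (I.prefU u')[0] := h.man_entry u' h0
  have h8 : (1 - if ((I.prefU u')[0] : ℕ) = w then 1 else 0) = (I.prefU u').idxOf w := by
    rw [idxOf_eq hI hw' h0]; simp only [Fin.ext_iff]
  refine ⟨⟨?_, ?_, fun x hx hx' => ?_⟩, ?_⟩
  · simp [linkRival, Cmd.run, eval, capped, h16, h11, h18, h13, h.reg0, h.reg3, ← two_mul, h1,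
      h5, h6, h7, h8, h.man_start]
    omega
  · simp [linkRival, Cmd.run, eval, capped, h16, h.reg0, h.reg3, h2, ← two_mul, h3]
  · simp [linkRival, Cmd.run, eval, h16, h.reg0, ← two_mul, hx, hx']
  · simp [linkRival, Cmd.run, eval, h11, h18, h13, h6, h7, h8, h.man_start, hs]

/-- The dart `d` has been linked and its cost table is in bank `9`; nothing else in these banks has
changed. -/
structure SlotSet (I : RestrictedSM) (d : ℕ) (s s' : State) : Prop extends LinkSet I d s s' where
  cost : ∀ j < 3, ∀ i < 3, s'.mem 9 (9 * d + 3 * j + i) = I.dartCost d j i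
  other_cost : ∀ e j i, e ≠ d → j < 3 → i < 3 →
    s'.mem 9 (9 * e + 3 * j + i) = s.mem 9 (9 * e + 3 * j + i)

/-- For an empty list position no table is written; `h9` provides the zero costs in that case. -/
theorem run_initSlot (hI : I.ListsBoundedBy 2) {s : State} (h : Env I s) (u : Fin I.nU) {a : ℕ}
    (ha : a < 2) (hu : s.reg 2 = u)
    (h9 : ∀ j < 3, ∀ i < 3, s.mem 9 (9 * (2 * u + a) + 3 * j + i) = 0) :
    SlotSet I (2 * u + a) s ((initSlot a).run s) := by
  have huN := u.2
  set d := 2 * (u : ℕ) + a with hd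
  have hda : d % 2 = a := by omega
  have hdu : d / 2 = u := by omega
  have hd' : d < 2 * I.nU := by omega
  have hcap : min I.cap d = d := by unfold cap; omega
  obtain ⟨s₁, hs₁⟩ : ∃ s₁, (loadSlot a).run s = s₁ := ⟨_, rfl⟩
  have e1 : Env I s₁ := hs₁ ▸ h.run rfl
  have m1 : s₁.mem = s.mem := by rw [← hs₁]; rfl
  have r2 : s₁.reg 2 = u := by rw [← hs₁, ← hu]; exact run_reg_of_keepsReg rfl s
  have r10 : s₁.reg 10 = rowStart I.prefU u := by
    rw [← hs₁]; simp [loadSlot, Cmd.run, eval, hu, h.man_start]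
  have r16 : s₁.reg 16 = d := by
    rw [← hs₁]; simp [loadSlot, Cmd.run, eval, capped, hu, h.reg3, ← two_mul, ← hd, hcap]
  have r14 : s₁.reg 14 = 0 := by rw [← hs₁]; simp [loadSlot, Cmd.run, eval]
  have hcond : (lt (add (reg 10) (const a)) (load 0 (add (reg 2) (const 1)))).eval s₁ ≠ 0 ↔
      a < (I.prefU u).length := by
    simp [eval, r10, r2, e1.man_end]
  rw [initSlot, Cmd.run, hs₁, Cmd.run]
  by_cases hl : a < (I.prefU u).length
  · rw [if_pos (hcond.2 hl)]
    set w := (I.prefU u)[a] with hw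
    have he : I.edgeAt d = some (u, w) := edgeAt_eq_some.2 ⟨hdu, by
      rw [hda, List.getElem?_eq_getElem hl]⟩
    have hwu : w ∈ I.prefU u := List.getElem_mem hl
    have huw := (I.mutual_acceptable u w).1 hwu
    have h0 : 0 < (I.prefW w).length := List.length_pos_of_mem huw
    obtain ⟨s₂, hs₂⟩ : ∃ s₂, (loadEdge a).run s₁ = s₂ := ⟨_, rfl⟩
    have e2 : Env I s₂ := hs₂ ▸ e1.run rfl
    have m2 : s₂.mem = s.mem := by rw [← hs₂, ← m1]; rfl
    have k1 : s₁.mem 1 (rowStart I.prefU u + a) = w := e1.man_entry u hl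
    have k2 : s₁.mem 2 (rowStart I.prefU u + a) = I.label u w := e1.man_label u hl
    have k3 : s₁.mem 3 w = rowStart I.prefW w := e1.woman_start w
    have k4 : s₁.mem 4 (rowStart I.prefW w) = (I.prefW w)[0] := e1.woman_entry w h0
    have k5 : (1 - if ((I.prefW w)[0] : ℕ) = u then 1 else 0) = (I.prefW w).idxOf u := by
      rw [idxOf_eq' hI huw h0]; simp only [Fin.ext_iff]
    have q11 : s₂.reg 11 = w := by rw [← hs₂]; simp [loadEdge, Cmd.run, eval, r10, k1]
    have q12 : s₂.reg 12 = I.label u w := by rw [← hs₂]; simp [loadEdge, Cmd.run, eval, r10, k2]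
    have q18 : s₂.reg 18 = rowStart I.prefW w := by
      rw [← hs₂]; simp [loadEdge, Cmd.run, eval, r10, k1, k3]
    have q13 : s₂.reg 13 = (I.prefW w).idxOf u := by
      rw [← hs₂]; simp [loadEdge, Cmd.run, eval, r10, r2, k1, k3, k4, k5]
    have q14 : s₂.reg 14 = 0 := by rw [← hs₂, ← r14]; exact run_reg_of_keepsReg rfl s₁
    have q16 : s₂.reg 16 = d := by rw [← hs₂, ← r16]; exact run_reg_of_keepsReg rfl s₁
    have hcond2 : (lt (add (reg 18) (const 1)) (load 3 (add (reg 11) (const 1)))).eval s₂ ≠ 0 ↔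
        1 < (I.prefW w).length := by
      simp [eval, q11, q18, e2.woman_end]
    obtain ⟨s₃, hs₃⟩ : ∃ s₃, (Cmd.branch (lt (add (reg 18) (const 1))
      (load 3 (add (reg 11) (const 1)))) linkRival linkDummy).run s₂ = s₃ := ⟨_, rfl⟩
    have e3 : Env I s₃ := hs₃ ▸ e2.run rfl
    have m3 : s₃.mem 9 = s.mem 9 := by
      rw [← hs₃, ← m2]; exact run_mem_of_keepsBank rfl s₂
    have p12 : s₃.reg 12 = I.label u w := by rw [← hs₃, ← q12]; exact run_reg_of_keepsReg rfl s₂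
    have p13 : s₃.reg 13 = (I.prefW w).idxOf u := by
      rw [← hs₃, ← q13]; exact run_reg_of_keepsReg rfl s₂
    have p16 : s₃.reg 16 = d := by rw [← hs₃, ← q16]; exact run_reg_of_keepsReg rfl s₂
    obtain ⟨hlink, p14⟩ : LinkSet I d s₂ s₃ ∧ s₃.reg 14 = I.rivalSlot u w := by
      rw [← hs₃, Cmd.run]
      by_cases hlw : 1 < (I.prefW w).length
      · rw [if_pos (hcond2.2 hlw)]
        exact run_linkRival hI e2 he hlw q16 q11 q18 q13
      · rw [if_neg (fun h => hlw (hcond2.1 h))]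
        have hr := rival_eq_none hI hwu hlw
        refine ⟨run_linkDummy e2 hd' q16 (by simp [manMate, he, hr]), ?_⟩
        have : linkDummy.keepsReg 14 = true := rfl
        rw [run_reg_of_keepsReg this, q14]
        simp [rivalSlot, hr]
    obtain ⟨h4, h5⟩ := run_storeTable (b := 9) (r := 16) (v := costExpr a) (s := s₃)
      (fun j i => I.dartCost d j i) (by
        intro s' hr hm _ j _ i _
        have e4 : Env I s' := ⟨by rw [hr, e3.reg0], by rw [hr, e3.reg1], by rw [hr, e3.reg3],
          by rw [hr, e3.reg4], fun b hb i => by rw [hm b (by omega), e3.input b hb],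
          by rw [hm 7 (by omega), e3.pen0], by rw [hm 7 (by omega), e3.pen1]⟩
        rw [eval_costExpr e4, hr, p12, p13, p14]
        simp only [dartCost, he, hda])
    rw [p16] at h4 h5
    have h6 : ((storeTable 9 16 (costExpr a)).run s₃).mem 8 = s₃.mem 8 :=
      run_mem_of_keepsBank (storeTable_keepsBank _ _ (by omega)) _
    rw [Cmd.run, hs₂, Cmd.run, hs₃]
    refine ⟨⟨?_, ?_, fun x hx hx' => ?_⟩, h4, fun e j i he hj hi => ?_⟩
    · rw [h6, hlink.mate]
    · rw [h6, hlink.dummy]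
    · rw [h6, hlink.other x hx hx', m2]
    · rw [h5 e j i he hj hi, m3]
  · rw [if_neg (fun h => hl (hcond.1 h))]
    have he : I.edgeAt d = none := by
      cases he : I.edgeAt d with
      | none => rfl
      | some e =>
        obtain ⟨h1, h2⟩ := edgeAt_eq_some (u := e.1) (w := e.2) |>.1 he
        obtain ⟨h3, -⟩ := List.getElem?_eq_some_iff.1 h2
        obtain rfl : e.1 = u := Fin.ext (by omega)
        omega
    have hlink := run_linkDummy e1 hd' r16 (by simp [manMate, he])
    have hk : linkDummy.keepsBank 9 = true := rfl
    refine ⟨⟨hlink.mate, hlink.dummy, fun x hx hx' => ?_⟩, fun j hj i hi => ?_,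
      fun e j i _ _ _ => ?_⟩
    · rw [hlink.other x hx hx', m1]
    · rw [run_mem_of_keepsBank hk, m1, h9 j hj i hi]
      simp [dartCost, he]
    · rw [run_mem_of_keepsBank hk, m1]

theorem run_initTable {s : State} (h : Env I s) {d : ℕ} (h2 : s.reg 2 = d) :
    (∀ j < 3, ∀ i < 3, (initTable.run s).mem 10 (9 * d + 3 * j + i) =
      min I.cap (s.mem 9 (9 * d + 3 * j + i) + s.mem 9 (9 * s.mem 8 d + 3 * i + j))) ∧
    ∀ e j i, e ≠ d → j < 3 → i < 3 →
      (initTable.run s).mem 10 (9 * e + 3 * j + i) = s.mem 10 (9 * e + 3 * j + i) := by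
  obtain ⟨h4, h5⟩ := run_storeTable (b := 10) (r := 10) (v := fun j i =>
      capped (add (load 9 (cell (reg 10) j (const i))) (load 9 (cell (reg 11) i (const j)))))
    (s := (s.setReg 10 d).setReg 11 (s.mem 8 d)) (fun j i => min I.cap
      (s.mem 9 (9 * d + 3 * j + i) + s.mem 9 (9 * s.mem 8 d + 3 * i + j))) (by
      intro s' hr hm _ j _ i _
      simp [capped, eval, hr, hm 9 (by omega), h.reg3])
  simp only [State.setReg_reg] at h4 h5
  have : initTable.run s = (storeTable 10 10 fun j i =>
      capped (add (load 9 (cell (reg 10) j (const i)))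
        (load 9 (cell (reg 11) i (const j))))).run ((s.setReg 10 d).setReg 11 (s.mem 8 d)) := by
    simp [initTable, Cmd.run, eval, h2]
  rw [this]
  exact ⟨by simpa using h4, by simpa using h5⟩

end RestrictedSM

namespace RestrictedSM

open RAM RAM.Expr RAM.Cmd Elimination

variable {I : RestrictedSM}

/-- The tables in bank `10`. -/
def table (s : State) (d j i : ℕ) : ℕ := s.mem 10 (9 * d + 3 * j + i)

/-! ### Elimination -/

/-- The darts of man `u` and their mates are in registers `10` to `13`. -/
structure Loaded (I : RestrictedSM) (u : ℕ) (s s' : State) : Prop where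
  env : Env I s'
  mem : s'.mem = s.mem
  left : s'.reg 10 = 2 * u
  right : s'.reg 11 = 2 * u + 1
  left_mate : s'.reg 12 = s.mem 8 (2 * u)
  right_mate : s'.reg 13 = s.mem 8 (2 * u + 1)

theorem run_loadLinks {s : State} (h : Env I s) {u r : ℕ} (hu : u < I.nU) (hr : s.reg r = u)
    (hr' : r ≠ 10) : Loaded I u s ((loadLinks r).run s) := by
  have h1 : min I.cap (2 * u) = 2 * u := by unfold cap; omega
  have h2 : min I.cap (2 * u + 1) = 2 * u + 1 := by unfold cap; omega
  refine ⟨h.run rfl, rfl, ?_, ?_, ?_, ?_⟩ <;>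
    simp [loadLinks, Cmd.run, eval, capped, hr, hr', h.reg3, ← two_mul, h1, h2]

/-- The tables of the man's own darts are read while those of their mates are overwritten. By
`Linked.neighbours` the four darts are distinct, so the in-place update is sound. -/
theorem run_eliminate {N : ℕ} {s : State} (h : Env I s) {u : ℕ} (hu : u < I.nU)
    (h2 : s.reg 2 = u) (hN : N = I.nU) (hlink : Linked N u (s.mem 8) (table s)) :
    Step I.cap N u (s.mem 8) ((eliminate.run s).mem 8) (table s) (table (eliminate.run s)) := by
  subst hN
  obtain ⟨s₁, hs₁⟩ : ∃ s₁, (loadLinks 2).run s = s₁ := ⟨_, rfl⟩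
  have hL : Loaded I u s s₁ := hs₁ ▸ run_loadLinks h hu h2 (by omega)
  have hcond : (eq (reg 12) (reg 11)).eval s₁ ≠ 0 ↔ s.mem 8 (2 * u) = 2 * u + 1 := by
    simp [eval, hL.left_mate, hL.right]
  rw [eliminate, Cmd.run, hs₁, Cmd.run]
  by_cases hl : s.mem 8 (2 * u) = 2 * u + 1
  · rw [if_pos (hcond.2 hl), Cmd.run]
    have ht : table s₁ = table s := by unfold table; rw [hL.mem]
    rw [hL.mem, ht]
    exact ⟨fun _ => ⟨rfl, rfl⟩, fun h => absurd hl h, fun h => absurd hl h, fun h => absurd hl h,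
      fun h => absurd hl h, fun _ _ _ => rfl, fun _ _ _ _ _ _ _ => rfl⟩
  · rw [if_neg (fun h => hl (hcond.1 h))]
    obtain ⟨ha, hc, -, -, hac⟩ := hlink.neighbours hu hl
    -- Stated for any state preserving the two source tables, so that it applies during both table
    -- updates.
    have hbest : ∀ s' : State, s'.reg = s₁.reg → (∀ b ≠ 10, s'.mem b = s₁.mem b) →
        (∀ j < 3, ∀ i < 3, s'.mem 10 (9 * (2 * u) + 3 * j + i) = table s (2 * u) j i) →
        (∀ j < 3, ∀ i < 3, s'.mem 10 (9 * (2 * u + 1) + 3 * j + i) = table s (2 * u + 1) j i) →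
        ∀ i < 3, ∀ l < 3, (bestExpr i l).eval s' =
          bestCost I.cap (table s) (2 * u) (2 * u + 1) i l := by
      intro s' hr _ h0 h1 i hi l hl
      simp only [bestExpr, bestCost, capped, eval_min, eval, eval_cell, hr, hL.env.reg3, hL.left,
        hL.right]
      rw [h0 0 (by omega) i hi, h0 1 (by omega) i hi, h0 2 (by omega) i hi, h1 0 (by omega) l hl,
        h1 1 (by omega) l hl, h1 2 (by omega) l hl]
    obtain ⟨s₂, hs₂⟩ : ∃ s₂, (storeTable 10 12 bestExpr).run s₁ = s₂ := ⟨_, rfl⟩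
    have r2 : s₂.reg = s₁.reg := by
      rw [← hs₂]; funext r; exact run_reg_of_keepsReg (storeTable_keepsReg ..) _
    have m2 : ∀ b ≠ 10, s₂.mem b = s₁.mem b := by
      intro b hb; rw [← hs₂]; exact run_mem_of_keepsBank (storeTable_keepsBank _ _ hb) _
    obtain ⟨h4, h5⟩ := run_storeTable (b := 10) (r := 12) (v := bestExpr) (s := s₁)
      (bestCost I.cap (table s) (2 * u) (2 * u + 1)) (by
        intro s' hr hm ht
        rw [hL.left_mate] at ht
        refine hbest s' hr hm (fun j hj i hi => ?_) (fun j hj i hi => ?_)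
        · rw [ht _ _ _ (by omega) hj hi, hL.mem]; rfl
        · rw [ht _ _ _ (by omega) hj hi, hL.mem]; rfl)
    rw [hL.left_mate, hs₂] at h4 h5
    rw [hL.mem] at h5
    obtain ⟨s₃, hs₃⟩ : ∃ s₃, (storeTable 10 13 fun l i => bestExpr i l).run s₂ = s₃ := ⟨_, rfl⟩
    have r3 : s₃.reg = s₁.reg := by
      rw [← hs₃, ← r2]; funext r; exact run_reg_of_keepsReg (storeTable_keepsReg ..) _
    have m3 : s₃.mem 8 = s.mem 8 := by
      rw [← hs₃, ← hL.mem, ← m2 8 (by omega)]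
      exact run_mem_of_keepsBank (storeTable_keepsBank _ _ (by omega)) _
    obtain ⟨h6, h7⟩ := run_storeTable (b := 10) (r := 13) (v := fun l i => bestExpr i l) (s := s₂)
      (fun l i => bestCost I.cap (table s) (2 * u) (2 * u + 1) i l) (by
        intro s' hr hm ht l hl i hi
        rw [r2, hL.right_mate] at ht
        refine hbest s' (hr.trans r2) (fun b hb => (hm b hb).trans (m2 b hb))
          (fun j hj i hi => ?_) (fun j hj i hi => ?_) i hi l hl
        · rw [ht _ _ _ (by omega) hj hi, h5 _ _ _ (by omega) hj hi]; rfl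
        · rw [ht _ _ _ (by omega) hj hi, h5 _ _ _ (by omega) hj hi]; rfl)
    rw [r2, hL.right_mate, hs₃] at h6 h7
    rw [Cmd.run, hs₂, Cmd.run, hs₃]
    obtain ⟨s₄, hs₄⟩ : ∃ s₄, (Cmd.seq (.store 8 (reg 12) (reg 13))
      (.store 8 (reg 13) (reg 12))).run s₃ = s₄ := ⟨_, rfl⟩
    have m4 : s₄.mem 10 = s₃.mem 10 := by rw [← hs₄]; exact run_mem_of_keepsBank rfl _
    have n4 : ∀ x, s₄.mem 8 x = if x = s.mem 8 (2 * u + 1) then s.mem 8 (2 * u)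
        else if x = s.mem 8 (2 * u) then s.mem 8 (2 * u + 1) else s.mem 8 x := by
      intro x
      rw [← hs₄]
      simp [Cmd.run, eval, r3, hL.left_mate, hL.right_mate, m3]
    rw [hs₄]
    have t4 : ∀ d j i, table s₄ d j i = s₃.mem 10 (9 * d + 3 * j + i) := by
      intro d j i; unfold table; rw [m4]
    refine ⟨fun h => absurd h hl, fun _ => ?_, fun _ => ?_, fun _ i hi l hl => ?_,
      fun _ i hi l hl => ?_, fun d h1 h2 => ?_, fun d h1 h2 i hi l hl => ?_⟩
    · rw [n4, if_neg hac, if_pos rfl]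
    · rw [n4, if_pos rfl]
    · rw [t4, h7 _ _ _ hac hi hl, h4 i hi l hl]
    · rw [t4, h6 l hl i hi]
    · rw [n4, if_neg h2, if_neg h1]
    · rw [t4, h7 _ _ _ h2 hi hl, h5 _ _ _ h1 hi hl]; rfl

/-! ### Backtracking -/

theorem run_argmin {s : State} (x y z : Expr) (f : ℕ → ℕ) (h0 : x.eval s = f 0)
    (h1 : y.eval s = f 1) (h2 : z.eval s = f 2) :
    ((argmin x y z).run s).reg 17 < 3 ∧
      ∀ j < 3, f (((argmin x y z).run s).reg 17) ≤ f j := by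
  have key : ∃ v < 3, (∀ j < 3, f v ≤ f j) ∧ ((argmin x y z).run s).reg 17 = v := by
    have hmin : ∀ v, f v ≤ f 0 → f v ≤ f 1 → f v ≤ f 2 → ∀ j < 3, f v ≤ f j := by
      intro v _ _ _ j hj
      interval_cases j <;> assumption
    by_cases h3 : f 1 < f 0
    · by_cases h4 : f 2 < f 1
      · exact ⟨2, by omega, hmin 2 (by omega) (by omega) (by omega),
          by simp [argmin, Cmd.run, eval, h0, h1, h2, h3, h4]⟩
      · exact ⟨1, by omega, hmin 1 (by omega) (by omega) (by omega),
          by simp [argmin, Cmd.run, eval, h0, h1, h2, h3, h4]⟩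
    · by_cases h4 : f 2 < f 0
      · exact ⟨2, by omega, hmin 2 (by omega) (by omega) (by omega),
          by simp [argmin, Cmd.run, eval, h0, h1, h2, h3, h4]⟩
      · exact ⟨0, by omega, hmin 0 (by omega) (by omega) (by omega),
          by simp [argmin, Cmd.run, eval, h0, h1, h2, h3, h4]⟩
  obtain ⟨v, hv, hmin, he⟩ := key
  rw [he]
  exact ⟨hv, hmin⟩

theorem run_backtrack {s : State} (h : Env I s) {u : ℕ} (hu : u < I.nU)
    (h2 : s.reg 2 = I.nU - 1 - u) :
    ∃ v < 3, (∀ j < 3, nodeCost (s.mem 8) (table s) (s.mem 11) u v ≤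
        nodeCost (s.mem 8) (table s) (s.mem 11) u j) ∧
      ∀ x, (backtrack.run s).mem 11 x = if x = 2 * u ∨ x = 2 * u + 1 then v else s.mem 11 x := by
  obtain ⟨s₁, hs₁⟩ : ∃ s₁, (loadLinks 16).run (s.setReg 16 u) = s₁ := ⟨_, rfl⟩
  have hL : Loaded I u s s₁ := by
    have hE : Env I (s.setReg 16 u) := ⟨by simp [h.reg0], by simp [h.reg1], by simp [h.reg3],
      by simp [h.reg4], by simpa using h.input, h.pen0, h.pen1⟩
    have := run_loadLinks hE hu (r := 16) (by simp) (by omega)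
    rw [hs₁] at this
    exact ⟨this.env, this.mem, this.left, this.right, this.left_mate, this.right_mate⟩
  obtain ⟨s₂, hs₂⟩ : ∃ s₂, (s₁.setReg 14 (s.mem 11 (s.mem 8 (2 * u)))).setReg 15
    (s.mem 11 (s.mem 8 (2 * u + 1))) = s₂ := ⟨_, rfl⟩
  have m2 : s₂.mem = s.mem := by rw [← hs₂, ← hL.mem]; rfl
  have r10 : s₂.reg 10 = 2 * u := by rw [← hs₂]; simp [hL.left]
  have r11 : s₂.reg 11 = 2 * u + 1 := by rw [← hs₂]; simp [hL.right]
  have r12 : s₂.reg 12 = s.mem 8 (2 * u) := by rw [← hs₂]; simp [hL.left_mate]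
  have r14 : s₂.reg 14 = s.mem 11 (s.mem 8 (2 * u)) := by rw [← hs₂]; simp
  have r15 : s₂.reg 15 = s.mem 11 (s.mem 8 (2 * u + 1)) := by rw [← hs₂]; simp
  have hcond : (eq (reg 12) (reg 11)).eval s₂ ≠ 0 ↔ s.mem 8 (2 * u) = 2 * u + 1 := by
    simp [eval, r12, r11]
  obtain ⟨c, hc⟩ : ∃ c, Cmd.branch (eq (reg 12) (reg 11))
      (argmin (load 10 (cell (reg 10) 0 (const 0))) (load 10 (cell (reg 10) 1 (const 1)))
        (load 10 (cell (reg 10) 2 (const 2))))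
      (argmin (nodeExpr 0) (nodeExpr 1) (nodeExpr 2)) = c := ⟨_, rfl⟩
  have hmin : (c.run s₂).reg 17 < 3 ∧
      ∀ j < 3, nodeCost (s.mem 8) (table s) (s.mem 11) u ((c.run s₂).reg 17) ≤
        nodeCost (s.mem 8) (table s) (s.mem 11) u j := by
    rw [← hc, Cmd.run]
    by_cases hl : s.mem 8 (2 * u) = 2 * u + 1
    · rw [if_pos (hcond.2 hl)]
      refine run_argmin _ _ _ _ ?_ ?_ ?_ <;> simp [eval, nodeCost, hl, table, r10, m2]
    · rw [if_neg (fun h => hl (hcond.1 h))]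
      refine run_argmin _ _ _ _ ?_ ?_ ?_ <;>
        simp [nodeExpr, eval, nodeCost, hl, table, r10, r11, r14, r15, m2]
  have k10 : (c.run s₂).reg 10 = 2 * u := by
    rw [← r10, ← hc]; exact run_reg_of_keepsReg rfl _
  have k11 : (c.run s₂).reg 11 = 2 * u + 1 := by
    rw [← r11, ← hc]; exact run_reg_of_keepsReg rfl _
  have km : (c.run s₂).mem 11 = s.mem 11 := by
    rw [← m2, ← hc]; exact run_mem_of_keepsBank rfl _
  have h16 : I.nU - 1 - (I.nU - 1 - u) = u := by omega
  refine ⟨(c.run s₂).reg 17, hmin.1, hmin.2, fun x => ?_⟩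
  have hrun : backtrack.run s = (Cmd.seq (.store 11 (reg 10) (reg 17))
      (.store 11 (reg 11) (reg 17))).run (c.run s₂) := by
    have e1 : (Cmd.assign 16 (sub (sub (reg 0) (const 1)) (reg 2))).run s = s.setReg 16 u := by
      simp [Cmd.run, eval, h.reg0, h2, h16]
    have e2 : (Cmd.assign 14 (load 11 (reg 12))).run s₁
        = s₁.setReg 14 (s.mem 11 (s.mem 8 (2 * u))) := by
      simp [Cmd.run, eval, hL.left_mate, hL.mem]
    have e3 : (Cmd.assign 15 (load 11 (reg 13))).run (s₁.setReg 14 (s.mem 11 (s.mem 8 (2 * u))))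
        = s₂ := by
      rw [← hs₂]
      simp [Cmd.run, eval, hL.right_mate, hL.mem]
    rw [backtrack, hc, Cmd.run, e1, Cmd.run, hs₁, Cmd.run, e2, Cmd.run, e3, Cmd.run]
  rw [hrun]
  simp only [Cmd.run, eval, State.setMem_reg, State.setMem_mem, k10, k11, km, true_and]
  by_cases h3 : x = 2 * u <;> by_cases h4 : x = 2 * u + 1 <;> simp [h3, h4]

/-! ### Output -/

/-- Nothing is written for an unmatched man, so the cell must initially hold 0. -/
theorem run_output {s : State} (h : Env I s) (u : Fin I.nU) (h2 : s.reg 2 = u)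
    (h6 : s.mem 6 u = 0) :
    ((output.run s).mem 6 u ≤ I.nW ∧ ∀ w, (u, w) ∈ I.matchingOf (s.mem 11) ↔
      (output.run s).mem 6 u = w + 1) ∧
    ∀ x ≠ (u : ℕ), (output.run s).mem 6 x = s.mem 6 x := by
  obtain ⟨x, hx⟩ : ∃ x, s.mem 11 (2 * u) = x := ⟨_, rfl⟩
  have hmem : ∀ w, (u, w) ∈ I.matchingOf (s.mem 11) ↔
      ∃ h : x - 1 < (I.prefU u).length, 0 < x ∧ (I.prefU u)[x - 1] = w := by
    intro w
    rw [mem_matchingOf, hx]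
    constructor
    · rintro ⟨h1, h2⟩
      have h3 := List.idxOf_lt_length_iff.2 h1
      refine ⟨by omega, by omega, ?_⟩
      simp only [h2, Nat.add_sub_cancel, List.getElem_idxOf]
    · rintro ⟨h1, h2, rfl⟩
      refine ⟨List.getElem_mem _, ?_⟩
      rw [(I.nodupU u).idxOf_getElem]
      omega
  have hx' : s.mem 11 (u + u) = x := by rw [← two_mul, hx]
  by_cases h3 : 0 < x ∧ x - 1 < (I.prefU u).length
  · obtain ⟨h3, h4⟩ := h3
    set w := (I.prefU u)[x - 1] with hw
    have h5 : s.mem 1 (rowStart I.prefU u + (x - 1)) = w := h.man_entry u h4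
    have hrun : ∀ y, (output.run s).mem 6 y = if y = u then (w : ℕ) + 1 else s.mem 6 y := by
      intro y
      simp [output, Cmd.run, eval, h2, hx', h.man_start, h.man_end, h3, h4, h.reg1, h5]
    refine ⟨⟨by rw [hrun, if_pos rfl]; omega, fun w' => ?_⟩, fun y hy => by rw [hrun, if_neg hy]⟩
    rw [hmem, hrun, if_pos rfl]
    simp only [h4, h3, true_and, exists_true_left, ← hw, Fin.ext_iff]
    omega
  · have hrun : ∀ y, (output.run s).mem 6 y = s.mem 6 y := by
      intro y
      by_cases h4 : 0 < x
      · have h5 : ¬ x - 1 < (I.prefU u).length := fun h5 => h3 ⟨h4, h5⟩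
        simp [output, Cmd.run, eval, h2, hx', h.man_start, h.man_end, h4, h5]
      · simp [output, Cmd.run, eval, h2, hx', h4]
    refine ⟨⟨by rw [hrun, h6]; omega, fun w' => ?_⟩, fun y _ => hrun y⟩
    rw [hmem, hrun, h6]
    constructor
    · rintro ⟨h4, h5, -⟩; exact absurd ⟨h5, h4⟩ h3
    · intro h; omega

end RestrictedSM

namespace RestrictedSM

open RAM RAM.Expr RAM.Cmd Elimination

variable {I : RestrictedSM}

/-! ### The loops -/

open Classical in
/-- Register `5` tells if there is a feasible matching, and banks `6` and `11` are empty. -/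
structure Ready (I : RestrictedSM) (s : State) : Prop where
  env : Env I s
  flag : s.reg 5 = if ∃ M, I.IsFeasible M then 1 else 0
  zero6 : ∀ x, s.mem 6 x = 0
  zero11 : ∀ x, s.mem 11 x = 0

theorem Ready.run {s : State} (h : Ready I s) {c : Cmd} (h1 : keepsEnv c = true)
    (h2 : c.keepsReg 5 = true) (h3 : c.keepsBank 6 = true) (h4 : c.keepsBank 11 = true) :
    Ready I (c.run s) :=
  ⟨h.env.run h1, by rw [run_reg_of_keepsReg h2, h.flag],
    fun x => by rw [run_mem_of_keepsBank h3, h.zero6],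
    fun x => by rw [run_mem_of_keepsBank h4, h.zero11]⟩

theorem Ready.setReg {s : State} (h : Ready I s) (v : ℕ) : Ready I (s.setReg 2 v) :=
  ⟨h.env.setReg v, by simp [h.flag], h.zero6, h.zero11⟩

open Classical in
/-- The state while the lists are checked for forced edges that share an agent. -/
structure Checking (I : RestrictedSM) (k l : ℕ) (s : State) : Prop where
  env : Env I s
  flag : s.reg 5 = if ForcedOnce I k l then 1 else 0
  zero6 : ∀ x, s.mem 6 x = 0
  zero9 : ∀ x, s.mem 9 x = 0
  zero11 : ∀ x, s.mem 11 x = 0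

/-- The darts of the first `k` men have been linked and have cost tables. -/
structure Linking (I : RestrictedSM) (k : ℕ) (s : State) : Prop where
  ready : Ready I s
  mate : ∀ d < 2 * k, s.mem 8 d = I.mate d ∧ s.mem 8 (2 * I.nU + d) = I.mate (2 * I.nU + d)
  cost : ∀ d < 2 * k, ∀ j < 3, ∀ i < 3, s.mem 9 (9 * d + 3 * j + i) = I.dartCost d j i
  zero : ∀ d j i, 2 * k ≤ d → j < 3 → i < 3 → s.mem 9 (9 * d + 3 * j + i) = 0

/-- The first `k` darts have tables for their links. -/
structure Tabulating (I : RestrictedSM) (k : ℕ) (s : State) : Prop where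
  ready : Ready I s
  mate : ∀ d < 4 * I.nU, s.mem 8 d = I.mate d
  cost : ∀ d j i, j < 3 → i < 3 → s.mem 9 (9 * d + 3 * j + i) = I.dartCost d j i
  table : ∀ d < k, ∀ j < 3, ∀ i < 3, table s d j i = I.linkCost d j i

/-- The capped cost of an assignment. -/
def cappedCost (I : RestrictedSM) (X : ℕ → ℕ) : ℕ :=
  min I.cap (total I.nU 0 I.mate I.linkCost X)

/-- The first `k` men have been eliminated. -/
structure Eliminating (I : RestrictedSM) (k : ℕ) (s : State) : Prop where
  ready : Ready I s
  preserves : Preserves I.cap I.nU k I.cappedCost (s.mem 8) (table s)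
  retired : Retired k (s.mem 8)

open Classical in
/-- The last `k` men have their final states. -/
structure Backtracking (I : RestrictedSM) (k : ℕ) (s : State) : Prop where
  env : Env I s
  flag : s.reg 5 = if ∃ M, I.IsFeasible M then 1 else 0
  zero6 : ∀ x, s.mem 6 x = 0
  preserves : Preserves I.cap I.nU I.nU I.cappedCost (s.mem 8) (table s)
  retired : Retired I.nU (s.mem 8)
  assignment : Assignment I.nU (s.mem 11)
  optimal : ∀ u < I.nU, I.nU ≤ u + k → ∀ j < 3,
    nodeCost (s.mem 8) (table s) (s.mem 11) u (s.mem 11 (2 * u)) ≤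
      nodeCost (s.mem 8) (table s) (s.mem 11) u j

open Classical in
/-- The partners of the first `k` men have been written. -/
structure Writing (I : RestrictedSM) (k : ℕ) (s : State) : Prop where
  env : Env I s
  flag : s.reg 5 = if ∃ M, I.IsFeasible M then 1 else 0
  assignment : Assignment I.nU (s.mem 11)
  optimal : ∀ Y, Assignment I.nU Y → I.cappedCost (s.mem 11) ≤ I.cappedCost Y
  written : ∀ u : Fin I.nU, (u : ℕ) < k → s.mem 6 u ≤ I.nW ∧
    ∀ w, (u, w) ∈ I.matchingOf (s.mem 11) ↔ s.mem 6 u = w + 1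
  zero6 : ∀ x, k ≤ x → s.mem 6 x = 0

variable {W n : ℕ}

/-- This segment stores sums and is not tame; its values, at most `4 * nU + 2`, are bounded
directly. -/
theorem triple_prelude (hW : 8 * (I.n + 1) ≤ W) :
    Triple W n (fun s => s = I.initialState) prelude (Checking I 0 0) := by
  have hn : I.nU ≤ I.n := by unfold RestrictedSM.n; omega
  refine Triple.of_safe (by omega) rfl ?_ ?_
  · rintro s hs rfl
    simp [prelude, Safe, Cmd.run, eval, initialState]
    omega
  · rintro s rfl
    refine ⟨⟨?_, ?_, ?_, ?_, fun b hb i => ?_, ?_, ?_⟩, ?_, fun x => ?_, fun x => ?_, fun x => ?_⟩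
    · simp [prelude, Cmd.run, eval, initialState]
    · simp [prelude, Cmd.run, eval, initialState]
    · simp [prelude, Cmd.run, eval, initialState, cap]; omega
    · simp [prelude, Cmd.run, eval, initialState]; omega
    · have : b ≠ 7 := by omega
      simp [prelude, Cmd.run, eval, initialState, this]
    · simp [prelude, Cmd.run, eval, initialState, inputBank]
    · simp [prelude, Cmd.run, eval, initialState, penalty]; omega
    · rw [if_pos ⟨fun u hu => by omega, fun w hw => by omega⟩]
      simp [prelude, Cmd.run, eval]
    all_goals simp [prelude, Cmd.run, eval, initialState, inputBank]

theorem triple_checkMen (hI : I.ListsBoundedBy 2) (hW : 8 ≤ W) (hn : I.nU ≤ 4 * n) :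
    Triple W n (Checking I 0 0) (forLoop 2 0 (checkForced 0)) (Checking I I.nU 0) := by
  refine Triple.forLoop hW rfl rfl rfl (by omega) hn (fun k s => Checking I k 0 s)
    (fun _ _ h => h.env.reg0)
    (fun k s v h => ⟨h.env.setReg v, by simp [h.flag], h.zero6, h.zero9, h.zero11⟩)
    (fun k s hk h2 h => ⟨h.env.run rfl, ?_, ?_, ?_, ?_⟩)
  · exact run_checkForced_man hI h.env ⟨k, hk⟩ h2 h.flag
  · rw [run_mem_of_keepsBank rfl]; exact h.zero6
  · rw [run_mem_of_keepsBank rfl]; exact h.zero9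
  · rw [run_mem_of_keepsBank rfl]; exact h.zero11

theorem triple_checkWomen (hI : I.ListsBoundedBy 2) (hW : 8 ≤ W) (hn : I.nW ≤ 4 * n) :
    Triple W n (Checking I I.nU 0) (forLoop 2 1 (checkForced 3)) (Linking I 0) := by
  refine (Triple.forLoop hW rfl rfl rfl (by omega) hn (fun k s => Checking I I.nU k s)
    (fun _ _ h => h.env.reg1)
    (fun k s v h => ⟨h.env.setReg v, by simp [h.flag], h.zero6, h.zero9, h.zero11⟩)
    (fun k s hk h2 h => ⟨h.env.run rfl, ?_, ?_, ?_, ?_⟩)).conseq (fun _ h => h)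
    (fun s h => ⟨⟨h.env, ?_, h.zero6, h.zero11⟩, fun d hd => by omega, fun d hd => by omega,
      fun d j i _ _ _ => h.zero9 _⟩)
  · exact run_checkForced_woman hI h.env ⟨k, hk⟩ h2 h.flag
  · rw [run_mem_of_keepsBank rfl]; exact h.zero6
  · rw [run_mem_of_keepsBank rfl]; exact h.zero9
  · rw [run_mem_of_keepsBank rfl]; exact h.zero11
  · classical exact h.flag.trans (if_congr forcedOnce_iff rfl rfl)

theorem Linking.step (hI : I.ListsBoundedBy 2) {k : ℕ} {s : State} (hk : k < I.nU)
    (h2 : s.reg 2 = k) (h : Linking I k s) :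
    Linking I (k + 1) ((Cmd.seq (initSlot 0) (initSlot 1)).run s) := by
  have h0 : SlotSet I (2 * k) s ((initSlot 0).run s) :=
    run_initSlot hI h.ready.env ⟨k, hk⟩ (a := 0) (by omega) h2
      (fun j hj i hi => h.zero _ j i (by simp) hj hi)
  obtain ⟨s₁, hs₁⟩ : ∃ s₁, (initSlot 0).run s = s₁ := ⟨_, rfl⟩
  have r1 : Ready I s₁ := hs₁ ▸ h.ready.run rfl rfl rfl rfl
  have k2 : s₁.reg 2 = k := by rw [← hs₁, ← h2]; exact run_reg_of_keepsReg rfl s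
  rw [hs₁] at h0
  have h1 : SlotSet I (2 * k + 1) s₁ ((initSlot 1).run s₁) :=
    run_initSlot hI r1.env ⟨k, hk⟩ (a := 1) (by omega) k2 (fun j hj i hi => by
      rw [h0.other_cost _ j i (by simp only; omega) hj hi]
      exact h.zero _ j i (by simp only; omega) hj hi)
  rw [Cmd.run, hs₁]
  refine ⟨r1.run rfl rfl rfl rfl, fun d hd => ?_, fun d hd j hj i hi => ?_,
    fun d j i hd hj hi => ?_⟩
  · obtain hd | rfl | rfl : d < 2 * k ∨ d = 2 * k ∨ d = 2 * k + 1 := by omega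
    · rw [h1.other _ (by omega) (by omega), h1.other _ (by omega) (by omega),
        h0.other _ (by omega) (by omega), h0.other _ (by omega) (by omega)]
      exact h.mate d hd
    · rw [h1.other _ (by omega) (by omega), h1.other _ (by omega) (by omega)]
      exact ⟨h0.mate, h0.dummy⟩
    · exact ⟨h1.mate, h1.dummy⟩
  · obtain hd | rfl | rfl : d < 2 * k ∨ d = 2 * k ∨ d = 2 * k + 1 := by omega
    · rw [h1.other_cost _ _ _ (by omega) hj hi, h0.other_cost _ _ _ (by omega) hj hi]
      exact h.cost d hd j hj i hi
    · rw [h1.other_cost _ _ _ (by omega) hj hi]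
      exact h0.cost j hj i hi
    · exact h1.cost j hj i hi
  · rw [h1.other_cost _ _ _ (by omega) hj hi, h0.other_cost _ _ _ (by omega) hj hi]
    exact h.zero d j i (by omega) hj hi

theorem triple_initSlots (hI : I.ListsBoundedBy 2) (hW : 8 ≤ W) (hn : I.nU ≤ 4 * n) :
    Triple W n (Linking I 0) (forLoop 2 0 (.seq (initSlot 0) (initSlot 1))) (Tabulating I 0) := by
  refine (Triple.forLoop hW rfl rfl rfl (by omega) hn (Linking I) (fun _ _ h => h.ready.env.reg0)
    (fun k s v h => ⟨h.ready.setReg v, h.mate, h.cost, h.zero⟩)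
    (fun k s hk h2 h => h.step hI hk h2)).conseq (fun _ h => h)
    (fun s h => ⟨h.ready, fun d hd => ?_, fun d j i hj hi => ?_, fun d hd => by omega⟩)
  · by_cases hd' : d < 2 * I.nU
    · exact (h.mate d hd').1
    · have := (h.mate (d - 2 * I.nU) (by omega)).2
      rwa [show 2 * I.nU + (d - 2 * I.nU) = d by omega] at this
  · by_cases hd' : d < 2 * I.nU
    · exact h.cost d hd' j hj i hi
    · rw [h.zero d j i (by omega) hj hi]
      cases he : I.edgeAt d with
      | none => simp [dartCost, he]
      | some e => exact absurd (edgeAt_of_lt (u := e.1) (w := e.2) he).1 hd'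

theorem triple_initTables (hI : I.ListsBoundedBy 2) (hW : 8 ≤ W) (hn : I.nU ≤ n) :
    Triple W n (Tabulating I 0) (forLoop 2 4 initTable) (Eliminating I 0) := by
  refine (Triple.forLoop hW rfl rfl rfl (by omega) (N := 4 * I.nU) (by omega) (Tabulating I)
    (fun _ _ h => h.ready.env.reg4)
    (fun k s v h => ⟨h.ready.setReg v, h.mate, h.cost, h.table⟩)
    (fun k s hk h2 h => ?_)).conseq (fun _ h => h)
    (fun s h => ⟨h.ready, Preserves.zero (linked hI) h.mate h.table, fun u hu => by omega⟩)
  obtain ⟨h3, h4⟩ := run_initTable h.ready.env h2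
  refine ⟨h.ready.run rfl rfl rfl rfl, ?_, ?_, fun d hd j hj i hi => ?_⟩
  · rw [run_mem_of_keepsBank rfl]; exact h.mate
  · rw [run_mem_of_keepsBank rfl]; exact h.cost
  · unfold RestrictedSM.table
    by_cases hdk : d = k
    · subst hdk
      rw [h3 j hj i hi, h.cost d j i hj hi, h.mate d hk, h.cost _ i j hi hj]
      rfl
    · rw [h4 d j i hdk hj hi]
      exact h.table d (by omega) j hj i hi

theorem triple_eliminate (hW : 8 ≤ W) (hn : I.nU ≤ 4 * n) :
    Triple W n (Eliminating I 0) (forLoop 2 0 eliminate) (Backtracking I 0) := by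
  refine (Triple.forLoop hW rfl rfl rfl (by omega) hn (Eliminating I)
    (fun _ _ h => h.ready.env.reg0)
    (fun k s v h => ⟨h.ready.setReg v, h.preserves, h.retired⟩)
    (fun k s hk h2 h => ?_)).conseq (fun _ h => h)
    (fun s h => ⟨h.ready.env, h.ready.flag, h.ready.zero6, h.preserves, h.retired, ?_,
      fun u hu hu' => by omega⟩)
  · have hs := run_eliminate h.ready.env hk h2 rfl h.preserves.linked
    exact ⟨h.ready.run rfl rfl rfl rfl, h.preserves.step hk hs,
      h.retired.step h.preserves.linked hk hs⟩
  · exact ⟨fun d => by rw [h.ready.zero11]; omega,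
      fun u _ => by rw [h.ready.zero11, h.ready.zero11], fun d _ => h.ready.zero11 d⟩

/-- The cost at a man depends on his mates only through still later darts, by `Retired`. Setting the
state of an earlier man therefore does not disturb the optimality already achieved. -/
theorem Backtracking.step {k : ℕ} {s : State} (hk : k < I.nU) (h2 : s.reg 2 = k)
    (h : Backtracking I k s) : Backtracking I (k + 1) (backtrack.run s) := by
  obtain ⟨u, hu⟩ : ∃ u, u = I.nU - 1 - k := ⟨_, rfl⟩
  obtain ⟨v, hv, hmin, hx⟩ := run_backtrack h.env (u := u) (by omega) (by omega)
  have h8 : (backtrack.run s).mem 8 = s.mem 8 := run_mem_of_keepsBank rfl s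
  have ht : table (backtrack.run s) = table s := by
    have : (backtrack.run s).mem 10 = s.mem 10 := run_mem_of_keepsBank rfl s
    unfold table; rw [this]
  refine ⟨h.env.run rfl, ?_, ?_, ?_, ?_, ⟨fun d => ?_, fun u' hu' => ?_, fun d hd => ?_⟩,
    fun u' hu' hk' j hj => ?_⟩
  · rw [run_reg_of_keepsReg rfl]; exact h.flag
  · rw [run_mem_of_keepsBank rfl]; exact h.zero6
  · rw [h8, ht]; exact h.preserves
  · rw [h8]; exact h.retired
  · rw [hx]
    split_ifs
    exacts [hv, h.assignment.lt d]
  · rw [hx, hx]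
    have := h.assignment.node u' hu'
    split_ifs <;> first | rfl | omega
  · rw [hx, if_neg (by omega), h.assignment.dummy d hd]
  -- Here `u ≤ u'`, and the mates read by `nodeCost` lie beyond `u'`, so they are not darts of `u`.
  · have hcost : ∀ i, nodeCost (s.mem 8) (table s) ((backtrack.run s).mem 11) u' i =
        nodeCost (s.mem 8) (table s) (s.mem 11) u' i := by
      intro i
      unfold nodeCost
      rcases h.retired u' hu' with h3 | ⟨h3, h4⟩
      · rw [if_pos h3, if_pos h3]
      · rw [hx, hx, if_neg (by omega : ¬ (s.mem 8 (2 * u') = 2 * u ∨ _)),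
          if_neg (by omega : ¬ (s.mem 8 (2 * u' + 1) = 2 * u ∨ _))]
    rw [h8, ht, hcost, hcost, hx]
    by_cases huu : u' = u
    · subst huu
      rw [if_pos (Or.inl rfl)]
      exact hmin j hj
    · rw [if_neg (by omega)]
      exact h.optimal u' hu' (by omega) j hj

theorem triple_backtrack (hW : 8 ≤ W) (hn : I.nU ≤ 4 * n) :
    Triple W n (Backtracking I 0) (forLoop 2 0 backtrack) (Writing I 0) := by
  refine (Triple.forLoop hW rfl rfl rfl (by omega) hn (Backtracking I)
    (fun _ _ h => h.env.reg0)
    (fun k s v h => ⟨h.env.setReg v, by simp [h.flag], h.zero6, h.preserves, h.retired,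
      h.assignment, h.optimal⟩)
    (fun k s hk h2 h => h.step hk h2)).conseq (fun _ h => h)
    (fun s h => ⟨h.env, h.flag, h.assignment, fun Y hY => ?_, fun u hu => by omega,
      fun x _ => h.zero6 x⟩)
  exact h.preserves.optimal h.assignment hY fun u hu => h.optimal u hu (by omega)

theorem triple_output (hW : 8 ≤ W) (hn : I.nU ≤ 4 * n) :
    Triple W n (Writing I 0) (forLoop 2 0 output) (Writing I I.nU) := by
  refine Triple.forLoop hW rfl rfl rfl (by omega) hn (Writing I) (fun _ _ h => h.env.reg0)
    (fun k s v h => ⟨h.env.setReg v, by simp [h.flag], h.assignment, h.optimal, h.written,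
      h.zero6⟩)
    (fun k s hk h2 h => ?_)
  have h11 : (output.run s).mem 11 = s.mem 11 := run_mem_of_keepsBank rfl s
  obtain ⟨h3, h4⟩ := run_output h.env ⟨k, hk⟩ h2 (h.zero6 k le_rfl)
  refine ⟨h.env.run rfl, ?_, by rw [h11]; exact h.assignment, by rw [h11]; exact h.optimal,
    fun u hu => ?_, fun x hx => ?_⟩
  · rw [run_reg_of_keepsReg rfl]; exact h.flag
  · rw [h11]
    by_cases huk : (u : ℕ) = k
    · obtain rfl : u = ⟨k, hk⟩ := Fin.ext huk
      exact h3
    · rw [h4 u huk]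
      exact h.written u (by omega)
  · rw [h4 x (by simp only; omega)]
    exact h.zero6 x (by omega)

theorem triple_answer (hI : I.ListsBoundedBy 2) (hW : 8 ≤ W) :
    Triple W n (Writing I I.nU) (.assign 0 (reg 5)) I.IsCorrectOutput := by
  refine Triple.of_tame hW rfl fun s h => ?_
  by_cases hf : ∃ M, I.IsFeasible M
  · refine Or.inl ⟨by simp [Cmd.run, eval, h.flag, hf], I.matchingOf (s.mem 11),
      isOptimal_matchingOf hI h.assignment h.optimal hf, fun u => ?_⟩
    exact h.written u u.2
  · exact Or.inr ⟨by simp [Cmd.run, eval, h.flag, hf], fun M hM => hf ⟨M, hM⟩⟩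

theorem triple_program (hI : I.ListsBoundedBy 2) :
    Triple (8 * (I.n + 1)) I.n (fun s => s = I.initialState) program I.IsCorrectOutput := by
  have hU : I.nU ≤ I.n := by unfold n; omega
  have hW : I.nW ≤ I.n := by unfold n; omega
  have h8 : 8 ≤ 8 * (I.n + 1) := by omega
  exact (triple_prelude le_rfl).seq <| (triple_checkMen hI h8 (by omega)).seq <|
    (triple_checkWomen hI h8 (by omega)).seq <| (triple_initSlots hI h8 (by omega)).seq <|
    (triple_initTables hI h8 hU).seq <| (triple_eliminate h8 (by omega)).seq <|
    (triple_backtrack h8 (by omega)).seq <| (triple_output h8 (by omega)).seq <|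
    triple_answer hI h8

end RestrictedSM

/-- The problem of finding a matching with the minimum number of blocking edges subject to the
constraints on restricted edges is solvable in `O(n)` time if all preference lists have length at
most `2`: a single program solves it within `C * (n + 1)` units of time, on words of
`log n + O(1)` bits. -/
theorem mainTheorem10 :
    ∃ (prog : RAM.Cmd) (C : ℕ), ∀ I : RestrictedSM, I.ListsBoundedBy 2 →
      ∃ (s : RAM.State) (t : ℕ),
        RAM.Exec (C * (I.n + 1)) prog I.initialState s t ∧
          t ≤ C * (I.n + 1) ∧ I.IsCorrectOutput s := by
  -- One constant serves both bounds: words need `weight * W` with `W = 8 * (n + 1)`, and time needs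
  -- `timeBound * (n + 1)`.
  refine ⟨RAM.program, RAM.program.weight * 8 + RAM.program.timeBound, fun I hI => ?_⟩
  obtain ⟨s, t, hex, ht, -, hs⟩ := RestrictedSM.triple_program hI
    ((RAM.program.weight * 8 + RAM.program.timeBound) * (I.n + 1)) I.initialState
    (by rw [← mul_assoc, add_mul]; exact Nat.le_add_right _ _)
    (RestrictedSM.initialState_bdd hI) rfl
  exact ⟨s, t, hex, ht.trans (Nat.mul_le_mul_right _ (Nat.le_add_left _ _)), hs⟩
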